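/- **Setting.** Messages are ground terms over a signature $\Sigma$ and over fresh and public names; $=_E$ is the congruence on messages generated by an equational theory $E$; variables are sorted (message, fresh, public) and instantiations respect sorts unless said otherwise. Fact symbols are linear or persistent. A multiset rewriting (MSR) system is a set of rules $\ell\xrightarrow{a}r$ of multisets of facts. It induces a labeled transition system (LTS) on multisets of ground facts, started in the empty multiset: for $\ell'\xrightarrow{a'}r'=_E(\ell\xrightarrow{a}r)\theta$ with $\theta$ a ground instantiation, a state $S$ that contains the linear facts of $\ell'$ (with multiplicity) and the persistent ones goes with label $a'$ to $S$ minus the linear part of $\ell'$ plus $r'$. For an LTS, $\mathrm{Tr}$ is the set of finite label sequences of runs from the initial state, and $\mathrm{Tr}_t$ is obtained by deleting empty labels and keeping only the sequences in which no fresh value $n$ has its generation recorded (by the action of the freshness rule) at two different positions. Some action symbols may carry equality restrictions, i.e. boolean combinations of equalities mod $E$ between their arguments; $\mathrm{Tr}_t(R)$ is then restricted to the traces in which all recorded checks hold (with no restrictions, this is the plain $\mathrm{Tr}_t(R)$). **Protocol model.** Fact symbols are partitioned into action symbols, environment symbols and, for each role $i\in\{1,\dots,n\}$, state symbols. Disjoint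 sets of environment symbols are declared as inputs (including $\mathsf{Fr}$, $\mathsf{in}$ and a symbol $\mathsf{Setup}_i$ for each role) and outputs (including $\mathsf{out}$); $\mathsf{K}$ is a persistent environment symbol that is neither. The MSR system is $R=R_{env}\cup\bigcup_i R_i$, where: labels contain action facts only; $R_{env}$ uses environment facts only and contains the Dolev–Yao message deduction rules and the freshness rule; a rule of $R_{env}$ that produces a $\mathsf{Setup}_i$ fact produces nothing else and has the empty label; rules in $R_i$ consume only state facts of role $i$ and input facts, and produce only state facts of role $i$ and output facts, at least one of them a state fact; for some $k_i\ge1$, the first $k_i$ arguments of all state facts and $\mathsf{Setup}_i$ facts agree within each rule of $R_i$, and the first argument of these facts, and of the $\mathsf{Setup}_i$ facts produced by $R_{env}$, is a variable $rid$ of sort fresh. **Components.** $R'_i$ arises from $R_i$ by replacing each input or output fact $F(\vec t)$, other than setup facts, by a buffered fact $F_i(rid,\vec t)$. The interface rules of role $i$ are $F(\vec x)\to F_i(rid,\vec x)$ for non-setup inputs $F$, $G_i(rid,\vec x)\to G(\vec x)$ for outputs $G$, and the setup rules for role $i$ in $R_{env}$. Each is split into a role half and an environment half (for inputs, outputs and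 setup, the role half only produces $F_i$, only consumes $G_i$, only produces $\mathsf{Setup}_i$, and the environment half only consumes $F$, only produces $G$, only consumes the premises of the setup rule, respectively), both labeled by the same synchronization fact $\lambda(rid,\vec x)$, which identifies the rule and has all its variables as arguments. $\Lambda$ is the set of all ground instances of these labels. $R^e_{env}$ consists of the non-setup rules of $R_{env}$ and all environment halves, and its transitions must satisfy the equality checks recorded in their labels. **I/O specifications.** For each role $i$ and fresh name $rid$, $\psi_i(rid)=\exists p.\,\mathsf{token}(p)\star P_i(p,rid,\emptyset)$, where $P_i$ is the greatest solution of: $P_i(p,rid,S)$ is the iterated separating conjunction over all rules in $R'_i$ and all role halves of interface rules of the following formulas. For a rule $Q\in R'_i$ with variables $\vec x$: for all instances $\ell',a',r'$ (mod $E$) of $Q$ with thread identifier $rid$ such that $\ell'$ matches $S$ and the equality checks recorded in $a'$ hold, there is $p'$ with an internal permission $Q(p,\vec x,\ell',a',r',p')\star P_i(p',rid,S')$, $S'$ being the updated state. For an output $G$: for all $\vec x$ with $G_i(rid,\vec x)\in S$, there is $p'$ with a permission $G(p,rid,\vec x,p')\star P_i(p',rid,S')$. For an input or setup rule: there are $p'$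 and $\vec z$ with a permission $(p,rid,\vec z,p')$ for it $\star\,P_i(p',rid,S')$, where $S'$ adds the produced fact. Heaps are (possibly infinite) multisets of tokens and permissions. $\mathrm{Tr}(\phi)$ is the set of those sequences that every heap model of $\phi$ can produce by moving tokens through permissions, where anything may follow once a received input differs from the value predicted by the heap. **Programs and environment.** $\gamma$ is a surjective $\Sigma$-algebra homomorphism from messages to a bytestring algebra which respects $=_E$. The programs $c_i(rid)$ have arbitrary LTSs $\mathscr C_i(rid)$, whose labels are internal permissions and interface operations $(rid,\vec b,\vec m)$ with bytestrings $\vec b$ and ghost terms $\vec m$. The partial map $\pi'_{ext}$ removes $\vec b$ and is defined if $\vec b=\gamma(\vec m)$; $\pi_{ext}$ maps interface permissions to their labels $\lambda$; $\pi_{int}$ maps internal permissions to their actions $a'$. The concrete environment $\mathscr E$ is the LTS of $R^e_{env}$ with each label $\lambda(rid,\vec m)$ renamed to $(rid,\gamma(\vec m),\vec m)$, and $\Lambda'=(\pi_{ext}\circ\pi'_{ext})^{-1}(\Lambda)$. $|||$ is interleaving, and $\|_{\Lambda'}$ synchronizes on labels in $\Lambda'$ (mod $E$), giving the empty label, and interleaves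 all other labels. **Corollary (Property preservation).** Let $\vdash_\alpha\{\phi\}\,c\,\{\mathsf{true}\}$ be the judgment of a code verifier for which the verifier assumption holds: whenever $\vdash_\alpha\{\phi\}\,c\,\{\mathsf{true}\}$, the LTS $\mathscr C$ of $c$ satisfies $\alpha(\mathrm{Tr}(\mathscr C))\subseteq\mathrm{Tr}(\phi)$ (in particular, $\alpha$ is defined on all labels of traces of $\mathscr C$). Suppose that $\vdash_{\pi'_{ext}}\{\psi_i(rid)\}\,c_i(rid)\,\{\mathsf{true}\}$ for each role $i$ and each fresh name $rid$. Then every trace property $\Phi$ that holds for $R$ also holds for the composed concrete system: $$\mathrm{Tr}_t(R)\subseteq\Phi\quad\Longrightarrow\quad \mathrm{Tr}_t\Big(\big(|||_{i,rid}\,\pi_{int}(\mathscr C_i(rid))\big)\,\|_{\Lambda'}\,\mathscr E\Big)\subseteq\Phi .$$ -/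

import Mathlib

universe u v w

namespace ProtoImpl

noncomputable section

/-! ## Terms, messages, equational theories -/

/-- Sorts of variables: arbitrary messages, fresh names, public names. -/
inductive VarSort
  | msg
  | fresh
  | pub

/-- The variables: countably many of each sort. -/
structure Var where
  sort : VarSort
  idx : ℕ

/-- A signature of function symbols, and the sets of fresh and of public names. -/
structure TermSig where
  Fn : Type u
  arity : Fn → ℕ
  Fresh : Type u
  Pub : Type u
  fresh_nonempty : Nonempty Fresh
  pub_nonempty : Nonempty Pub

/-- Terms over names and variables from `V`. -/
inductive Term (T : TermSig.{u}) (V : Type) : Type u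
  | fresh (a : T.Fresh) : Term T V
  | pub (a : T.Pub) : Term T V
  | var (x : V) : Term T V
  | app (f : T.Fn) (ts : Fin (T.arity f) → Term T V) : Term T V

/-- Messages are ground terms. -/
abbrev Msg (T : TermSig.{u}) : Type u := Term T Empty

def Term.subst {T : TermSig.{u}} {V W : Type} (θ : V → Term T W) : Term T V → Term T W
  | .fresh a => .fresh a
  | .pub a => .pub a
  | .var x => θ x
  | .app f ts => .app f (fun j => (ts j).subst θ)

def Term.vars {T : TermSig.{u}} {V : Type} : Term T V → Set V
  | .fresh _ => ∅
  | .pub _ => ∅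
  | .var x => {x}
  | .app _ ts => ⋃ j, (ts j).vars

/-- A ground instantiation of the variables that respects their sorts. -/
def WellSorted {T : TermSig.{u}} (θ : Var → Msg T) : Prop :=
  ∀ x : Var, match x.sort with
    | .msg => True
    | .fresh => ∃ a, θ x = .fresh a
    | .pub => ∃ a, θ x = .pub a

/-- An equational theory is a set of equations between terms. -/
abbrev EqTheory (T : TermSig.{u}) : Type u := Set (Term T Var × Term T Var)

/-- Equality of messages modulo `E`: the least congruence on ground terms that contains all
ground instances of the equations. -/
inductive EqMod {T : TermSig.{u}} (E : EqTheory T) : Msg T → Msg T → Prop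
  | ax {l r : Term T Var} (θ : Var → Msg T) (hθ : WellSorted θ) (h : (l, r) ∈ E) :
      EqMod E (l.subst θ) (r.subst θ)
  | refl (m : Msg T) : EqMod E m m
  | symm {m m' : Msg T} : EqMod E m m' → EqMod E m' m
  | trans {m m' m'' : Msg T} : EqMod E m m' → EqMod E m' m'' → EqMod E m m''
  | congr (f : T.Fn) (ts us : Fin (T.arity f) → Msg T) (h : ∀ j, EqMod E (ts j) (us j)) :
      EqMod E (.app f ts) (.app f us)

/-! ## Facts and rules -/

/-- A signature of fact symbols; `Arg s` indexes the arguments of `s`, and the symbols that are not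
persistent are linear. -/
structure FactSig where
  Sym : Type u
  Arg : Sym → Type
  Pers : Sym → Prop

structure Fact (T : TermSig.{u}) (F : FactSig.{u}) (V : Type) : Type u where
  sym : F.Sym
  args : F.Arg sym → Term T V

/-- Ground facts. -/
abbrev GFact (T : TermSig.{u}) (F : FactSig.{u}) : Type u := Fact T F Empty

def Fact.subst {T : TermSig.{u}} {F : FactSig.{u}} {V W : Type} (θ : V → Term T W)
    (f : Fact T F V) : Fact T F W :=
  ⟨f.sym, fun j => (f.args j).subst θ⟩

def Fact.vars {T : TermSig.{u}} {F : FactSig.{u}} {V : Type} (f : Fact T F V) : Set V :=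
  ⋃ j, (f.args j).vars

inductive Fact.EqMod {T : TermSig.{u}} {F : FactSig.{u}} (E : EqTheory T) :
    GFact T F → GFact T F → Prop
  | mk (s : F.Sym) (ts us : F.Arg s → Msg T) (h : ∀ j, ProtoImpl.EqMod E (ts j) (us j)) :
      Fact.EqMod E ⟨s, ts⟩ ⟨s, us⟩

/-- A rewrite rule `lhs --[act]--> rhs`. -/
structure Rule (T : TermSig.{u}) (F : FactSig.{u}) (V : Type) : Type u where
  lhs : Multiset (Fact T F V)
  act : Multiset (Fact T F V)
  rhs : Multiset (Fact T F V)

def Rule.subst {T : TermSig.{u}} {F : FactSig.{u}} {V W : Type} (θ : V → Term T W)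
    (R : Rule T F V) : Rule T F W :=
  ⟨R.lhs.map (Fact.subst θ), R.act.map (Fact.subst θ), R.rhs.map (Fact.subst θ)⟩

def Rule.vars {T : TermSig.{u}} {F : FactSig.{u}} {V : Type} (R : Rule T F V) : Set V :=
  {x | ∃ f ∈ R.lhs + R.act + R.rhs, x ∈ f.vars}

/-- `g =_E g'`, componentwise. -/
def Rule.EqMod {T : TermSig.{u}} {F : FactSig.{u}} (E : EqTheory T) (g g' : Rule T F Empty) :
    Prop :=
  Multiset.Rel (Fact.EqMod E) g.lhs g'.lhs ∧ Multiset.Rel (Fact.EqMod E) g.act g'.act ∧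
    Multiset.Rel (Fact.EqMod E) g.rhs g'.rhs

open Classical in
/-- The linear facts of a multiset. -/
def linPart {T : TermSig.{u}} {F : FactSig.{u}} (l : Multiset (GFact T F)) :
    Multiset (GFact T F) :=
  l.filter (fun f => ¬ F.Pers f.sym)

/-- The state `S` contains the left-hand side `l`. -/
def Matches {T : TermSig.{u}} {F : FactSig.{u}} (l S : Multiset (GFact T F)) : Prop :=
  linPart l ≤ S ∧ ∀ f ∈ l, F.Pers f.sym → f ∈ S

open Classical in
/-- The state `S` after consuming the linear facts of `l` and producing `r`. -/
def update {T : TermSig.{u}} {F : FactSig.{u}} (l r S : Multiset (GFact T F)) :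
    Multiset (GFact T F) :=
  S - linPart l + r

/-! ## Labeled transition systems, traces, compositions -/

structure LTS (L : Type u) where
  State : Type w
  start : State
  step : State → L → State → Prop

inductive LTS.Run {L : Type u} (M : LTS.{u, w} L) : M.State → List L → M.State → Prop
  | nil (s : M.State) : LTS.Run M s [] s
  | cons {s s' s'' : M.State} {a : L} {τ : List L} (h : M.step s a s') (hτ : LTS.Run M s' τ s'') :
      LTS.Run M s (a :: τ) s''

/-- The traces `Tr`. -/
def LTS.Tr {L : Type u} (M : LTS.{u, w} L) : Set (List L) :=
  {τ | ∃ s, M.Run M.start τ s}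

open Classical in
/-- The filtered traces `Tr'`, with the empty label `ε` removed. -/
def LTS.TrFiltered {L : Type u} (M : LTS.{u, w} L) (ε : L) : Set (List L) :=
  {τ | ∃ τ₀ ∈ M.Tr, τ = τ₀.filter (fun a => a ≠ ε)}

/-- The traces `Tr_t`: filtered traces in which no fresh value is generated at two positions.
`gen n a` says that the label `a` records the generation of `n`. -/
def LTS.TrT {L : Type u} (M : LTS.{u, w} L) (ε : L) {N : Type v} (gen : N → L → Prop) :
    Set (List L) :=
  {τ | τ ∈ M.TrFiltered ε ∧
    ∀ (n : N) (i j : Fin τ.length), gen n (τ.get i) → gen n (τ.get j) → i = j}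

/-- Relabeling along a relation between old and new labels. -/
def LTS.relabel {L : Type u} {L' : Type v} (M : LTS.{u, w} L) (ρ : L → L' → Prop) :
    LTS.{v, w} L' where
  State := M.State
  start := M.start
  step s b s' := ∃ a, ρ a b ∧ M.step s a s'

open Classical in
/-- Interleaving composition of a family of systems. -/
def LTS.interleave {L : Type u} {ι : Type v} (M : ι → LTS.{u, w} L) : LTS.{u, max v w} L where
  State := ∀ k, (M k).State
  start := fun k => (M k).start
  step f a f' := ∃ (k : ι) (s' : (M k).State), (M k).step (f k) a s' ∧ f' = Function.update f k s'

/-- Composition synchronizing on the labels in `Λ` (up to `eqv`); a synchronized transition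
gets the empty label `ε`. -/
def LTS.sync {L : Type u} (ε : L) (eqv : L → L → Prop) (Λ : Set L) (M₁ : LTS.{u, v} L)
    (M₂ : LTS.{u, w} L) : LTS.{u, max v w} L where
  State := M₁.State × M₂.State
  start := (M₁.start, M₂.start)
  step s a s' :=
    (a = ε ∧ ∃ b, (∃ c ∈ Λ, eqv b c) ∧ M₁.step s.1 b s'.1 ∧ M₂.step s.2 b s'.2) ∨
    ((¬ ∃ c ∈ Λ, eqv a c) ∧ M₁.step s.1 a s'.1 ∧ s'.2 = s.2) ∨
    ((¬ ∃ c ∈ Λ, eqv a c) ∧ M₂.step s.2 a s'.2 ∧ s'.1 = s.1)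

/-- The transition system of a set of rewrite rules. The condition `chk` is imposed on the label
of each transition; the standard semantics has `chk = True`. -/
def msrLTS {T : TermSig.{u}} {F : FactSig.{u}} (E : EqTheory T)
    (chk : Multiset (GFact T F) → Prop) (rules : Set (Rule T F Var)) :
    LTS.{u, u} (Multiset (GFact T F)) where
  State := Multiset (GFact T F)
  start := 0
  step S a S' := ∃ R ∈ rules, ∃ θ : Var → Msg T, WellSorted θ ∧ ∃ g : Rule T F Empty,
    g.EqMod E (R.subst θ) ∧ Matches g.lhs S ∧ chk g.act ∧ a = g.act ∧ S' = update g.lhs g.rhs S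

/-! ## Protocol models and their format -/

/-- The fact symbols of an `n`-role protocol, split by type into action symbols, environment
symbols and the state symbols of each role. Whether an action symbol is linear is immaterial, since
actions never occur in states; they count as linear. -/
structure ProtoSig (n : ℕ) where
  Act : Type u
  actArity : Act → ℕ
  Env : Type u
  envArity : Env → ℕ
  envPers : Env → Prop
  St : Fin n → Type u
  stArity : ∀ i, St i → ℕ
  stPers : ∀ i, St i → Prop
  inS : Set Env
  outS : Set Env
  in_out_disjoint : Disjoint inS outS
  /-- The reserved environment symbols: freshness, network input and output, attacker knowledge. -/
  fr : Env
  inp : Env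
  out : Env
  know : Env
  fr_mem : fr ∈ inS
  inp_mem : inp ∈ inS
  out_mem : out ∈ outS
  know_not_mem : know ∉ inS ∪ outS
  fr_arity : envArity fr = 1
  inp_arity : envArity inp = 1
  out_arity : envArity out = 1
  know_arity : envArity know = 1
  fr_lin : ¬ envPers fr
  inp_lin : ¬ envPers inp
  out_lin : ¬ envPers out
  know_pers : envPers know
  setup : Fin n → Env
  setup_mem : ∀ i, setup i ∈ inS
  /-- The action recording the generation of a fresh name. -/
  frAct : Act
  frAct_arity : actArity frAct = 1
  /-- The action recording that the attacker sends a message that he knows. -/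
  knowAct : Act
  knowAct_arity : actArity knowAct = 1

/-- The fact symbols of the protocol model. -/
inductive BaseSym {n : ℕ} (P : ProtoSig.{u} n) : Type u
  | act (a : P.Act) : BaseSym P
  | env (e : P.Env) : BaseSym P
  | st (i : Fin n) (s : P.St i) : BaseSym P

def BaseSym.arity {n : ℕ} {P : ProtoSig.{u} n} : BaseSym P → ℕ
  | .act a => P.actArity a
  | .env e => P.envArity e
  | .st i s => P.stArity i s

def BaseSym.Pers {n : ℕ} {P : ProtoSig.{u} n} : BaseSym P → Prop
  | .act _ => False
  | .env e => P.envPers e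
  | .st i s => P.stPers i s

def ProtoSig.base {n : ℕ} (P : ProtoSig.{u} n) : FactSig.{u} where
  Sym := BaseSym P
  Arg := fun s => Fin s.arity
  Pers := BaseSym.Pers

/-- The input symbols other than the role setup symbols. -/
def ProtoSig.inMinus {n : ℕ} (P : ProtoSig.{u} n) : Set P.Env :=
  {F | F ∈ P.inS ∧ ∀ i, F ≠ P.setup i}

/-- A protocol model: the environment's rules and the rules of each role. -/
structure Model (T : TermSig.{u}) {n : ℕ} (P : ProtoSig.{u} n) where
  env : Set (Rule T P.base Var)
  role : Fin n → Set (Rule T P.base Var)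

/-- The multiset rewriting system of the whole model. -/
def Model.rules {T : TermSig.{u}} {n : ℕ} {P : ProtoSig.{u} n} (R : Model T P) :
    Set (Rule T P.base Var) :=
  R.env ∪ ⋃ i, R.role i

/-- An environment fact with a single argument. -/
def envFact {T : TermSig.{u}} {n : ℕ} {P : ProtoSig.{u} n} (e : P.Env) (t : Term T Var) :
    Fact T P.base Var :=
  ⟨.env e, fun _ => t⟩

/-- An action fact with a single argument. -/
def actFact {T : TermSig.{u}} {n : ℕ} {P : ProtoSig.{u} n} (a : P.Act) (t : Term T Var) :
    Fact T P.base Var :=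
  ⟨.act a, fun _ => t⟩

/-- The message variables `x₀, x₁, …`. -/
def msgVar (j : ℕ) : Var := ⟨.msg, j⟩

/-- The message deduction rules of the attacker. The argument `logged` says whether sending a
message is recorded by an action or has the empty label; both conventions are common. -/
inductive Deduction (T : TermSig.{u}) {n : ℕ} (P : ProtoSig.{u} n) (logged : Prop) :
    Rule T P.base Var → Prop
  | receive : Deduction T P logged
      ⟨{envFact P.out (.var (msgVar 0))}, 0, {envFact P.know (.var (msgVar 0))}⟩
  | send (h : ¬ logged) : Deduction T P logged
      ⟨{envFact P.know (.var (msgVar 0))}, 0, {envFact P.inp (.var (msgVar 0))}⟩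
  | sendLogged (h : logged) : Deduction T P logged
      ⟨{envFact P.know (.var (msgVar 0))}, {actFact P.knowAct (.var (msgVar 0))},
        {envFact P.inp (.var (msgVar 0))}⟩
  | pub : Deduction T P logged ⟨0, 0, {envFact P.know (.var ⟨.pub, 0⟩)}⟩
  | fresh : Deduction T P logged
      ⟨{envFact P.fr (.var ⟨.fresh, 0⟩)}, 0, {envFact P.know (.var ⟨.fresh, 0⟩)}⟩
  | app (f : T.Fn) : Deduction T P logged
      ⟨(Finset.univ : Finset (Fin (T.arity f))).val.map
          (fun j => envFact P.know (.var (msgVar j))),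
        0, {envFact P.know (.app f (fun j => .var (msgVar j)))}⟩

/-- The freshness rule. -/
def freshRule (T : TermSig.{u}) {n : ℕ} (P : ProtoSig.{u} n) : Rule T P.base Var :=
  ⟨0, {actFact P.frAct (.var ⟨.fresh, 0⟩)}, {envFact P.fr (.var ⟨.fresh, 0⟩)}⟩

/-- The first argument of the fact is the variable `x`. -/
def HeadVar {T : TermSig.{u}} {n : ℕ} {P : ProtoSig.{u} n} (f : Fact T P.base Var) (x : Var) :
    Prop :=
  ∃ h : 0 < BaseSym.arity f.sym, f.args ⟨0, h⟩ = .var x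

/-- The first `k` arguments of the fact are `ini`. -/
def HasParams {T : TermSig.{u}} {n : ℕ} {P : ProtoSig.{u} n} {k : ℕ} (ini : Fin k → Term T Var)
    (f : Fact T P.base Var) : Prop :=
  ∀ j : Fin k, ∃ h : j.1 < BaseSym.arity f.sym, f.args ⟨j.1, h⟩ = ini j

/-- A tuple of role parameters: it starts with the thread identifier, a variable of sort fresh. -/
def StartsWithRid {T : TermSig.{u}} {k : ℕ} (ini : Fin k → Term T Var) : Prop :=
  ∃ (h : 0 < k) (x : Var), x.sort = .fresh ∧ ini ⟨0, h⟩ = .var x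

/-- The format of protocol models. -/
structure Model.Format {T : TermSig.{u}} {n : ℕ} {P : ProtoSig.{u} n} (R : Model T P) : Prop where
  /-- Labels contain action facts only. -/
  act_facts : ∀ r ∈ R.rules, ∀ f ∈ r.act, ∃ a, f.sym = .act a
  /-- Environment rules use environment facts only. -/
  env_facts : ∀ r ∈ R.env, ∀ f ∈ r.lhs + r.rhs, ∃ e, f.sym = .env e
  /-- The attacker and the freshness rule belong to the environment. -/
  deduction : ∃ logged : Prop, ∀ r, Deduction T P logged r → r ∈ R.env
  fresh_rule : freshRule T P ∈ R.env
  /-- A setup rule produces its setup fact only and has the empty label. -/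
  setup_rule : ∀ i, ∀ r ∈ R.env, ∀ f ∈ r.rhs, f.sym = .env (P.setup i) → r.rhs = {f} ∧ r.act = 0
  /-- Role rules consume own state facts and inputs, and produce own state facts and outputs. -/
  role_lhs : ∀ i, ∀ r ∈ R.role i, ∀ f ∈ r.lhs,
    (∃ s, f.sym = .st i s) ∨ ∃ e ∈ P.inS, f.sym = .env e
  role_rhs : ∀ i, ∀ r ∈ R.role i, ∀ f ∈ r.rhs,
    (∃ s, f.sym = .st i s) ∨ ∃ e ∈ P.outS, f.sym = .env e
  role_state : ∀ i, ∀ r ∈ R.role i, ∃ f ∈ r.rhs, ∃ s, f.sym = .st i s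
  /-- The first `k` arguments of the setup and state facts of a role are its parameters, which agree
  within each rule. -/
  params : ∀ i, ∃ k : ℕ,
    (∀ r ∈ R.role i, ∃ ini : Fin k → Term T Var, StartsWithRid ini ∧ ∀ f ∈ r.lhs + r.rhs,
      (f.sym = .env (P.setup i) ∨ ∃ s, f.sym = .st i s) → HasParams ini f) ∧
    (∀ r ∈ R.env, ∀ f ∈ r.rhs, f.sym = .env (P.setup i) →
      ∃ ini : Fin k → Term T Var, StartsWithRid ini ∧ HasParams ini f)

/-! ## Equality restrictions -/

/-- Boolean combinations of equalities between `k` variables. -/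
inductive EqFormula (k : ℕ) : Type
  | eq (i j : Fin k) : EqFormula k
  | neg (φ : EqFormula k) : EqFormula k
  | and (φ ψ : EqFormula k) : EqFormula k
  | or (φ ψ : EqFormula k) : EqFormula k

def EqFormula.Holds {T : TermSig.{u}} (E : EqTheory T) {k : ℕ} (t : Fin k → Msg T) :
    EqFormula k → Prop
  | .eq i j => EqMod E (t i) (t j)
  | .neg φ => ¬ φ.Holds E t
  | .and φ ψ => φ.Holds E t ∧ ψ.Holds E t
  | .or φ ψ => φ.Holds E t ∨ ψ.Holds E t

/-- An assignment of equality formulas to some of the action symbols. -/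
abbrev EqRestriction {n : ℕ} (P : ProtoSig.{u} n) : Type u :=
  ∀ a : P.Act, Option (EqFormula (P.actArity a))

/-! ## Component models -/

/-- The setup rules for role `i` in the environment, with the thread identifier variable `x`. -/
def Model.IsSetup {T : TermSig.{u}} {n : ℕ} {P : ProtoSig.{u} n} (R : Model T P) (i : Fin n)
    (r : Rule T P.base Var) (x : Var) : Prop :=
  r ∈ R.env ∧ ∃ f ∈ r.rhs, f.sym = .env (P.setup i) ∧ HeadVar f x

/-- Names of the interface operations of role `i`: one for each non-setup input or output symbol and
one for each setup rule. -/
inductive SyncSym (T : TermSig.{u}) {n : ℕ} (P : ProtoSig.{u} n) : Type u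
  | buf (i : Fin n) (F : P.Env) : SyncSym T P
  | setup (i : Fin n) (r : Rule T P.base Var) (x : Var) : SyncSym T P

/-- The parameters of an interface operation besides the thread identifier: the arguments of the
fact, respectively the other variables of the setup rule. -/
def SyncSym.Param {T : TermSig.{u}} {n : ℕ} {P : ProtoSig.{u} n} : SyncSym T P → Type
  | .buf _ F => Fin (P.envArity F)
  | .setup _ r x => {y : Var // y ∈ r.vars ∧ y ≠ x}

/-- The operations whose parameters besides the thread identifier are received by the role. -/
def SyncSym.IsInput {T : TermSig.{u}} {n : ℕ} {P : ProtoSig.{u} n} : SyncSym T P → Prop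
  | .buf _ F => F ∈ P.inS
  | .setup _ _ _ => True

/-- The fact symbols of the component models: those of the model, the buffered copies, and the
synchronization labels. -/
inductive ExtSym (T : TermSig.{u}) {n : ℕ} (P : ProtoSig.{u} n) : Type u
  | base (s : BaseSym P) : ExtSym T P
  | buf (i : Fin n) (F : P.Env) : ExtSym T P
  | sync (q : SyncSym T P) : ExtSym T P

/-- Buffered facts and synchronization labels have the thread identifier as an additional first
argument, with index `none`. -/
def ExtSym.Arg {T : TermSig.{u}} {n : ℕ} {P : ProtoSig.{u} n} : ExtSym T P → Type
  | .base s => Fin s.arity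
  | .buf _ F => Option (Fin (P.envArity F))
  | .sync q => Option q.Param

def ExtSym.Pers {T : TermSig.{u}} {n : ℕ} {P : ProtoSig.{u} n} : ExtSym T P → Prop
  | .base s => s.Pers
  | .buf _ F => P.envPers F
  | .sync _ => False

def extSig (T : TermSig.{u}) {n : ℕ} (P : ProtoSig.{u} n) : FactSig.{u} where
  Sym := ExtSym T P
  Arg := ExtSym.Arg
  Pers := ExtSym.Pers

/-- A fact of the model as a fact of the components. -/
def liftFact {T : TermSig.{u}} {n : ℕ} {P : ProtoSig.{u} n} {V : Type} (f : Fact T P.base V) :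
    Fact T (extSig T P) V :=
  ⟨.base f.sym, f.args⟩

def liftRule {T : TermSig.{u}} {n : ℕ} {P : ProtoSig.{u} n} {V : Type} (r : Rule T P.base V) :
    Rule T (extSig T P) V :=
  ⟨r.lhs.map liftFact, r.act.map liftFact, r.rhs.map liftFact⟩

/-- The fact `F_i(rid, t)`. -/
def bufFact {T : TermSig.{u}} {n : ℕ} {P : ProtoSig.{u} n} {V : Type} (i : Fin n) (F : P.Env)
    (rid : Term T V) (t : Fin (P.envArity F) → Term T V) : Fact T (extSig T P) V :=
  ⟨.buf i F, fun o => Option.elim o rid t⟩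

/-- The fact `F(t)`, for an environment symbol `F`. -/
def extEnvFact {T : TermSig.{u}} {n : ℕ} {P : ProtoSig.{u} n} {V : Type} (F : P.Env)
    (t : Fin (P.envArity F) → Term T V) : Fact T (extSig T P) V :=
  ⟨.base (.env F), t⟩

/-- The synchronization label `λ_q(rid, t)`. -/
def syncFact {T : TermSig.{u}} {n : ℕ} {P : ProtoSig.{u} n} {V : Type} (q : SyncSym T P)
    (rid : Term T V) (t : q.Param → Term T V) : Fact T (extSig T P) V :=
  ⟨.sync q, fun o => Option.elim o rid t⟩

open Classical in
/-- Replacing an input or output fact `F(t)`, except setup facts, by `F_i(rid, t)`. -/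
def bufferFact {T : TermSig.{u}} {n : ℕ} {P : ProtoSig.{u} n} (i : Fin n) (rid : Var) :
    Fact T P.base Var → Fact T (extSig T P) Var
  | ⟨.env F, t⟩ => if F ∈ P.inMinus ∪ P.outS then bufFact i F (.var rid) t else extEnvFact F t
  | f => liftFact f

def bufferRule {T : TermSig.{u}} {n : ℕ} {P : ProtoSig.{u} n} (i : Fin n) (rid : Var)
    (r : Rule T P.base Var) : Rule T (extSig T P) Var :=
  ⟨r.lhs.map (bufferFact i rid), r.act.map liftFact, r.rhs.map (bufferFact i rid)⟩

/-- The thread identifier variable of a role rule: the first argument of its state facts. -/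
def IsRid {T : TermSig.{u}} {n : ℕ} {P : ProtoSig.{u} n} (i : Fin n) (r : Rule T P.base Var)
    (x : Var) : Prop :=
  ∃ f ∈ r.lhs + r.rhs, (∃ s, f.sym = .st i s) ∧ HeadVar f x

/-- The thread identifier variable of the rules for buffered facts. -/
def ridVar : Var := ⟨.fresh, 0⟩

/-- The tuple of variables `x₀, …` for the arguments of `F`. -/
def argVars {T : TermSig.{u}} {n : ℕ} {P : ProtoSig.{u} n} (F : P.Env) :
    Fin (P.envArity F) → Term T Var :=
  fun j => .var (msgVar j)

/-- The label of the rule that buffers `F` for role `i`. -/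
def bufLabel (T : TermSig.{u}) {n : ℕ} {P : ProtoSig.{u} n} (i : Fin n) (F : P.Env) :
    Fact T (extSig T P) Var :=
  syncFact (.buf i F) (.var ridVar) (argVars F)

/-- The label of a setup rule; its parameters are all variables of the rule. -/
def setupLabel {T : TermSig.{u}} {n : ℕ} {P : ProtoSig.{u} n} (i : Fin n)
    (r : Rule T P.base Var) (x : Var) : Fact T (extSig T P) Var :=
  syncFact (.setup i r x) (.var x) (fun y => .var y.1)

/-- The role's half of the interface rules of role `i`. -/
inductive Model.RoleHalf {T : TermSig.{u}} {n : ℕ} {P : ProtoSig.{u} n} (R : Model T P)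
    (i : Fin n) : Rule T (extSig T P) Var → Prop
  | input (F : P.Env) (h : F ∈ P.inMinus) :
      RoleHalf R i ⟨0, {bufLabel T i F}, {bufFact i F (.var ridVar) (argVars F)}⟩
  | output (G : P.Env) (h : G ∈ P.outS) :
      RoleHalf R i ⟨{bufFact i G (.var ridVar) (argVars G)}, {bufLabel T i G}, 0⟩
  | setup (r : Rule T P.base Var) (x : Var) (h : R.IsSetup i r x) :
      RoleHalf R i ⟨0, {setupLabel i r x}, r.rhs.map liftFact⟩

/-- The environment's half of the interface rules. -/
inductive Model.EnvHalf {T : TermSig.{u}} {n : ℕ} {P : ProtoSig.{u} n} (R : Model T P) :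
    Rule T (extSig T P) Var → Prop
  | input (i : Fin n) (F : P.Env) (h : F ∈ P.inMinus) :
      EnvHalf R ⟨{extEnvFact F (argVars F)}, {bufLabel T i F}, 0⟩
  | output (i : Fin n) (G : P.Env) (h : G ∈ P.outS) :
      EnvHalf R ⟨0, {bufLabel T i G}, {extEnvFact G (argVars G)}⟩
  | setup (i : Fin n) (r : Rule T P.base Var) (x : Var) (h : R.IsSetup i r x) :
      EnvHalf R ⟨r.lhs.map liftFact, {setupLabel i r x}, 0⟩

/-- The environment component: the environment rules other than setup rules, and the environment's
half of the interface rules. -/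
def Model.envComponent {T : TermSig.{u}} {n : ℕ} {P : ProtoSig.{u} n} (R : Model T P) :
    Set (Rule T (extSig T P) Var) :=
  {r' | ∃ r ∈ R.env, (∀ i, ∀ f ∈ r.rhs, f.sym ≠ .env (P.setup i)) ∧ r' = liftRule r} ∪
    {r' | R.EnvHalf r'}

/-- The set of all ground instances of the synchronization labels. -/
def Model.syncLabels {T : TermSig.{u}} {n : ℕ} {P : ProtoSig.{u} n} (R : Model T P) :
    Set (Multiset (GFact T (extSig T P))) :=
  {a | ∃ i, ∃ r', R.RoleHalf i r' ∧ ∃ θ : Var → Msg T, a = (r'.subst θ).act}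

/-- The equality checks recorded in a label hold. -/
def EqChecks {T : TermSig.{u}} {n : ℕ} {P : ProtoSig.{u} n} (E : EqTheory T)
    (res : EqRestriction P) (a : Multiset (GFact T (extSig T P))) : Prop :=
  ∀ (f : P.Act) (φ : EqFormula (P.actArity f)), res f = some φ →
    ∀ t : Fin (P.actArity f) → Msg T, liftFact ⟨.act f, t⟩ ∈ a → φ.Holds E t

/-- The traces `Tr_t` of the model, under the equality restrictions `res`. -/
def Model.TrT {T : TermSig.{u}} {n : ℕ} {P : ProtoSig.{u} n} (R : Model T P) (E : EqTheory T)
    (res : EqRestriction P) : Set (List (Multiset (GFact T P.base))) :=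
  {τ | τ ∈ (msrLTS E (fun _ => True) R.rules).TrT 0
      (fun (m : Msg T) a => (⟨.act P.frAct, fun _ => m⟩ : GFact T P.base) ∈ a) ∧
    ∀ a ∈ τ, EqChecks E res (a.map liftFact)}

/-! ## Permissions, heaps, assertions -/

/-- The internal permission of a role rule, with the instantiation of the variables of the rule and
the instance (modulo `E`) of the rule. -/
structure IntPerm (T : TermSig.{u}) {n : ℕ} (P : ProtoSig.{u} n) : Type u where
  rule : Rule T (extSig T P) Var
  val : rule.vars → Msg T
  inst : Rule T (extSig T P) Empty

/-- The permission of an interface operation, at the level of terms. -/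
structure APerm (T : TermSig.{u}) {n : ℕ} (P : ProtoSig.{u} n) : Type u where
  op : SyncSym T P
  rid : Msg T
  arg : op.Param → Msg T

/-- The permission of an interface operation on bytestrings, with ghost terms. -/
structure CPerm (T : TermSig.{u}) {n : ℕ} (P : ProtoSig.{u} n) (B : Type u) : Type u where
  op : SyncSym T P
  rid : Msg T
  bytes : op.Param → B
  arg : op.Param → Msg T

/-- Labels of traces of I/O specifications. -/
abbrev SpecLabel (T : TermSig.{u}) {n : ℕ} (P : ProtoSig.{u} n) : Type u := IntPerm T P ⊕ APerm T P

/-- Labels of programs. -/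
abbrev ProgLabel (T : TermSig.{u}) {n : ℕ} (P : ProtoSig.{u} n) (B : Type u) : Type u :=
  IntPerm T P ⊕ CPerm T P B

/-- A supply of places that is large enough for distinct permissions to have distinct target
places. -/
abbrev Place (T : TermSig.{u}) {n : ℕ} (P : ProtoSig.{u} n) : Type u := List (SpecLabel T P)

/-- Heap chunks: tokens and permissions with a source and a target place. -/
inductive Chunk (T : TermSig.{u}) {n : ℕ} (P : ProtoSig.{u} n) : Type u
  | token (p : Place T P) : Chunk T P
  | perm (p : Place T P) (e : SpecLabel T P) (p' : Place T P) : Chunk T P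

/-- Heaps are (possibly infinite) multisets of chunks. -/
abbrev Heap (T : TermSig.{u}) {n : ℕ} (P : ProtoSig.{u} n) : Type u := Chunk T P → ℕ∞

open Classical in
def Heap.single {T : TermSig.{u}} {n : ℕ} {P : ProtoSig.{u} n} (c : Chunk T P) : Heap T P :=
  fun c' => if c' = c then 1 else 0

/-- The traces a heap can produce by pushing tokens through permissions. The heap predicts the
received values; if a received value differs from the prediction, then everything is allowed
afterwards. -/
inductive Heap.Produces {T : TermSig.{u}} {n : ℕ} {P : ProtoSig.{u} n} :
    Heap T P → List (SpecLabel T P) → Prop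
  | nil (h : Heap T P) : Heap.Produces h []
  | step (h : Heap T P) (p p' : Place T P) (e : SpecLabel T P) (τ : List (SpecLabel T P))
      (hτ : Heap.Produces (h + Heap.single (.token p')) τ) :
      Heap.Produces (h + Heap.single (.token p) + Heap.single (.perm p e p')) (e :: τ)
  | contradict (h : Heap T P) (p p' : Place T P) (q : SyncSym T P) (hq : q.IsInput) (rid : Msg T)
      (z z' : q.Param → Msg T) (hz : z ≠ z') (τ : List (SpecLabel T P)) :
      Heap.Produces (h + Heap.single (.token p) + Heap.single (.perm p (.inr ⟨q, rid, z⟩) p'))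
        (.inr ⟨q, rid, z'⟩ :: τ)

/-- Assertions, given by their heap models. -/
abbrev Assertion (T : TermSig.{u}) {n : ℕ} (P : ProtoSig.{u} n) : Type u := Heap T P → Prop

/-- The heap contains the chunk `c`. -/
def Assertion.chunk {T : TermSig.{u}} {n : ℕ} {P : ProtoSig.{u} n} (c : Chunk T P) :
    Assertion T P :=
  fun h => 1 ≤ h c

/-- Separating conjunction; heaps may contain more than what is asserted. -/
def Assertion.sep {T : TermSig.{u}} {n : ℕ} {P : ProtoSig.{u} n} (φ ψ : Assertion T P) :
    Assertion T P :=
  fun h => ∃ h₁ h₂ : Heap T P, h₁ + h₂ ≤ h ∧ φ h₁ ∧ ψ h₂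

/-- Iterated separating conjunction. -/
def Assertion.bigSep {T : TermSig.{u}} {n : ℕ} {P : ProtoSig.{u} n} {ι : Type v}
    (φ : ι → Assertion T P) : Assertion T P :=
  fun h => ∃ hs : ι → Heap T P, (∀ s : Finset ι, ∑ k ∈ s, hs k ≤ h) ∧ ∀ k, φ k (hs k)

/-- The traces of an assertion: those that all its heap models can produce. -/
def Assertion.Tr {T : TermSig.{u}} {n : ℕ} {P : ProtoSig.{u} n} (φ : Assertion T P) :
    Set (List (SpecLabel T P)) :=
  {τ | ∀ h, φ h → Heap.Produces h τ}

theorem Assertion.sep_mono {T : TermSig.{u}} {n : ℕ} {P : ProtoSig.{u} n}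
    {φ ψ ψ' : Assertion T P} (hψ : ψ ≤ ψ') : φ.sep ψ ≤ φ.sep ψ' := by
  rintro h ⟨h₁, h₂, hle, h1, h2⟩
  exact ⟨h₁, h₂, hle, h1, hψ _ h2⟩

/-! ## The I/O specification of a role -/

/-- The rules of the component of role `i`. -/
inductive Model.RoleRule {T : TermSig.{u}} {n : ℕ} {P : ProtoSig.{u} n} (R : Model T P)
    (i : Fin n) : Type u
  | proto (r : Rule T P.base Var) (x : Var) (hr : r ∈ R.role i) (hx : IsRid i r x) : RoleRule R i
  | output (G : P.Env) (h : G ∈ P.outS) : RoleRule R i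
  | input (F : P.Env) (h : F ∈ P.inMinus) : RoleRule R i
  | setup (r : Rule T P.base Var) (x : Var) (h : R.IsSetup i r x) : RoleRule R i

/-- The formula for the application of one rule in the state `S` at the place `p`; `X` stands for the
co-recursive call. -/
def Model.ruleFormula {T : TermSig.{u}} {n : ℕ} {P : ProtoSig.{u} n} (R : Model T P)
    (E : EqTheory T) (res : EqRestriction P) (i : Fin n) (rid : T.Fresh)
    (X : Place T P → Multiset (GFact T (extSig T P)) → Assertion T P)
    (p : Place T P) (S : Multiset (GFact T (extSig T P))) : R.RoleRule i → Assertion T P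
  | .proto r x _ _ => fun h =>
      ∀ (θ : Var → Msg T) (g : Rule T (extSig T P) Empty), WellSorted θ → θ x = .fresh rid →
        Matches g.lhs S → g.EqMod E ((bufferRule i x r).subst θ) → EqChecks E res g.act →
        ∃ p', ((Assertion.chunk (.perm p (.inl ⟨bufferRule i x r, fun y => θ y, g⟩) p')).sep
          (X p' (update g.lhs g.rhs S))) h
  | .output G _ => fun h =>
      ∀ z : Fin (P.envArity G) → Msg T, bufFact i G (.fresh rid) z ∈ S →
        ∃ p', ((Assertion.chunk (.perm p (.inr ⟨.buf i G, .fresh rid, z⟩) p')).sep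
          (X p' (update {bufFact i G (.fresh rid) z} 0 S))) h
  | .input F _ => fun h =>
      ∃ (p' : Place T P) (z : Fin (P.envArity F) → Msg T),
        ((Assertion.chunk (.perm p (.inr ⟨.buf i F, .fresh rid, z⟩) p')).sep
          (X p' (S + {bufFact i F (.fresh rid) z}))) h
  | .setup r x _ => fun h =>
      ∃ (p' : Place T P) (θ : Var → Msg T), θ x = .fresh rid ∧
        ((Assertion.chunk (.perm p (.inr ⟨.setup i r x, .fresh rid, fun y => θ y.1⟩) p')).sep
          (X p' (S + (r.rhs.map liftFact).map (Fact.subst θ)))) h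

/-- The body of the co-recursive definition of the specification predicate. -/
def Model.specBody {T : TermSig.{u}} {n : ℕ} {P : ProtoSig.{u} n} (R : Model T P)
    (E : EqTheory T) (res : EqRestriction P) (i : Fin n) (rid : T.Fresh) :
    (Place T P → Multiset (GFact T (extSig T P)) → Assertion T P) →o
      (Place T P → Multiset (GFact T (extSig T P)) → Assertion T P) where
  toFun X p S := Assertion.bigSep (R.ruleFormula E res i rid X p S)
  monotone' := by
    rintro X Y hXY p S h ⟨hs, hle, hφ⟩
    refine ⟨hs, hle, fun k => ?_⟩
    have hk := hφ k
    cases k with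
    | proto r x hr hx =>
      intro θ g h1 h2 h3 h4 h5
      obtain ⟨p', hp'⟩ := hk θ g h1 h2 h3 h4 h5
      exact ⟨p', Assertion.sep_mono (hXY _ _) _ hp'⟩
    | output G hG =>
      intro z hz
      obtain ⟨p', hp'⟩ := hk z hz
      exact ⟨p', Assertion.sep_mono (hXY _ _) _ hp'⟩
    | input F hF =>
      obtain ⟨p', z, hp'⟩ := hk
      exact ⟨p', z, Assertion.sep_mono (hXY _ _) _ hp'⟩
    | setup r x hr =>
      obtain ⟨p', θ, hθ, hp'⟩ := hk
      exact ⟨p', θ, hθ, Assertion.sep_mono (hXY _ _) _ hp'⟩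

/-- The predicate describing the permitted behavior of a role at place `p` in state `S`: the greatest
solution of its co-recursive definition. -/
def Model.specPred {T : TermSig.{u}} {n : ℕ} {P : ProtoSig.{u} n} (R : Model T P)
    (E : EqTheory T) (res : EqRestriction P) (i : Fin n) (rid : T.Fresh) :
    Place T P → Multiset (GFact T (extSig T P)) → Assertion T P :=
  OrderHom.gfp (R.specBody E res i rid)

/-- The I/O specification `ψ_i(rid)`. -/
def Model.ioSpec {T : TermSig.{u}} {n : ℕ} {P : ProtoSig.{u} n} (R : Model T P)
    (E : EqTheory T) (res : EqRestriction P) (i : Fin n) (rid : T.Fresh) : Assertion T P :=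
  fun h => ∃ p, ((Assertion.chunk (.token p)).sep (R.specPred E res i rid p 0)) h

/-! ## Bytestrings, programs, and the concrete system -/

/-- An algebra of bytestrings. -/
structure ByteOps (T : TermSig.{u}) (B : Type u) where
  fresh : T.Fresh → B
  pub : T.Pub → B
  app : ∀ f : T.Fn, (Fin (T.arity f) → B) → B

/-- The homomorphism `γ` from messages to bytestrings. -/
def ByteOps.gamma {T : TermSig.{u}} {B : Type u} (A : ByteOps T B) : Msg T → B
  | .fresh a => A.fresh a
  | .pub a => A.pub a
  | .var x => x.elim
  | .app f ts => A.app f (fun j => A.gamma (ts j))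

/-- A bytestring algebra: `γ` respects equality modulo `E` and is surjective. -/
structure ByteAlgebra {T : TermSig.{u}} (E : EqTheory T) (B : Type u) extends ByteOps T B where
  respects : ∀ m m' : Msg T, EqMod E m m' → toByteOps.gamma m = toByteOps.gamma m'
  surjective : Function.Surjective toByteOps.gamma

open Classical in
/-- The map `π'_ext` removes the bytestrings from an interface operation. It is undefined if they are
not the images of the ghost terms. -/
def piExtConc {T : TermSig.{u}} {n : ℕ} {P : ProtoSig.{u} n} {B X : Type u}
    (A : ByteOps T B) : X ⊕ CPerm T P B → Option (X ⊕ APerm T P)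
  | .inl x => some (.inl x)
  | .inr c => if c.bytes = fun j => A.gamma (c.arg j) then some (.inr ⟨c.op, c.rid, c.arg⟩) else none

/-- The map `π_ext` sends an interface permission to the synchronization label. -/
def piExt {T : TermSig.{u}} {n : ℕ} {P : ProtoSig.{u} n} :
    Multiset (GFact T (extSig T P)) ⊕ APerm T P → Multiset (GFact T (extSig T P))
  | .inl a => a
  | .inr e => {syncFact e.op e.rid e.arg}

/-- The map `π_int` sends an internal permission to its action facts. -/
def piInt {T : TermSig.{u}} {n : ℕ} {P : ProtoSig.{u} n} {Y : Type u} :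
    IntPerm T P ⊕ Y → Multiset (GFact T (extSig T P)) ⊕ Y
  | .inl e => .inl e.inst.act
  | .inr y => .inr y

/-- Labels of the composed concrete system. -/
abbrev SysLabel (T : TermSig.{u}) {n : ℕ} (P : ProtoSig.{u} n) (B : Type u) : Type u :=
  Multiset (GFact T (extSig T P)) ⊕ CPerm T P B

/-- Concrete interface labels that are equal modulo `E`. -/
inductive CPerm.EqMod {T : TermSig.{u}} {n : ℕ} {P : ProtoSig.{u} n} {B : Type u}
    (E : EqTheory T) : CPerm T P B → CPerm T P B → Prop
  | mk (q : SyncSym T P) (rid rid' : Msg T) (b : q.Param → B) (z z' : q.Param → Msg T)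
      (hr : ProtoImpl.EqMod E rid rid') (hz : ∀ j, ProtoImpl.EqMod E (z j) (z' j)) :
      CPerm.EqMod E ⟨q, rid, b, z⟩ ⟨q, rid', b, z'⟩

/-- Equality of system labels modulo `E`. -/
def SysLabel.EqMod {T : TermSig.{u}} {n : ℕ} {P : ProtoSig.{u} n} {B : Type u}
    (E : EqTheory T) : SysLabel T P B → SysLabel T P B → Prop :=
  Sum.LiftRel (Multiset.Rel (Fact.EqMod E)) (CPerm.EqMod E)

/-- The renaming of the labels of the environment component: a synchronization label becomes an
interface label with bytestrings; other labels are kept. -/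
inductive EnvRename {T : TermSig.{u}} {n : ℕ} {P : ProtoSig.{u} n} {B : Type u}
    (A : ByteOps T B) : Multiset (GFact T (extSig T P)) → SysLabel T P B → Prop
  | sync (q : SyncSym T P) (rid : Msg T) (z : q.Param → Msg T) :
      EnvRename A {syncFact q rid z} (.inr ⟨q, rid, fun j => A.gamma (z j), z⟩)
  | keep (a : Multiset (GFact T (extSig T P))) (h : ∀ q rid z, a ≠ {syncFact q rid z}) :
      EnvRename A a (.inl a)

/-- The concrete environment. -/
def Model.concEnv {T : TermSig.{u}} {n : ℕ} {P : ProtoSig.{u} n} {B : Type u} (R : Model T P)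
    (E : EqTheory T) (res : EqRestriction P) (A : ByteOps T B) : LTS.{u, u} (SysLabel T P B) :=
  (msrLTS E (EqChecks E res) R.envComponent).relabel (EnvRename A)

/-- The set `Λ'` of concrete synchronization labels. -/
def Model.concSyncLabels {T : TermSig.{u}} {n : ℕ} {P : ProtoSig.{u} n} {B : Type u}
    (R : Model T P) (A : ByteOps T B) : Set (SysLabel T P B) :=
  {c | ∃ e, piExtConc A c = some e ∧ piExt e ∈ R.syncLabels}

/-- The composed concrete system of the programs' transition systems `C i rid` and the concrete
environment. -/
def Model.system {T : TermSig.{u}} {n : ℕ} {P : ProtoSig.{u} n} {B : Type u} (R : Model T P)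
    (E : EqTheory T) (res : EqRestriction P) (A : ByteOps T B)
    (C : Fin n → T.Fresh → LTS.{u, w} (ProgLabel T P B)) : LTS.{u, max u w} (SysLabel T P B) :=
  LTS.sync (.inl 0) (SysLabel.EqMod E) (R.concSyncLabels A)
    (LTS.interleave (fun k : Fin n × T.Fresh => (C k.1 k.2).relabel (fun a b => b = piInt a)))
    (R.concEnv E res A)

/-- The traces `Tr_t` of a system. -/
def systemTrT {T : TermSig.{u}} {n : ℕ} {P : ProtoSig.{u} n} {B : Type u}
    (M : LTS.{u, w} (SysLabel T P B)) : Set (List (SysLabel T P B)) :=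
  M.TrT (.inl 0) (fun (m : Msg T) c =>
    ∃ a, c = .inl a ∧ liftFact (⟨.act P.frAct, fun _ => m⟩ : GFact T P.base) ∈ a)

/-- A trace of multisets of action facts, as a trace of system labels. -/
def asSystemTrace {T : TermSig.{u}} {n : ℕ} {P : ProtoSig.{u} n} (B : Type u)
    (τ : List (Multiset (GFact T P.base))) : List (SysLabel T P B) :=
  τ.map (fun a => .inl (a.map liftFact))

/-- `α(C)` is trace-included in `φ`, for a partial relabeling `α`: it is defined on all labels of all
traces of `C`, and the relabeled traces are traces of `φ`. -/
def AbstractsTo {T : TermSig.{u}} {n : ℕ} {P : ProtoSig.{u} n} {B : Type u}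
    (α : ProgLabel T P B → Option (SpecLabel T P)) (C : LTS.{u, w} (ProgLabel T P B))
    (φ : Assertion T P) : Prop :=
  ∀ τ ∈ C.Tr, ∃ τ' ∈ φ.Tr, List.Forall₂ (fun c e => α c = some e) τ τ'

/-- Soundness of a code verifier that proves triples `{φ} c {true}` under an abstraction `α`, for a
programming language with semantics `sem`. -/
def VerifierAssumption {T : TermSig.{u}} {n : ℕ} {P : ProtoSig.{u} n} {B : Type u} {Prog : Type v}
    (sem : Prog → LTS.{u, w} (ProgLabel T P B))
    (Triple : (ProgLabel T P B → Option (SpecLabel T P)) → Assertion T P → Prog → Prop) : Prop :=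
  ∀ α φ c, Triple α φ c → AbstractsTo α (sem c) φ

end

end ProtoImpl

/-! The model simulates the composed concrete system: an unsynchronized transition becomes one model
step with the same label, and a synchronized one becomes at most one step with the empty label.

What verification says about a program is extracted from heaps. A trace of $\psi_i(rid)$ must be
producible by every heap model, so one well-chosen model already bounds it, and the choice may
depend on the trace `τ`. Take histories of events as places, one token at the empty history, and
infinitely many copies of a permission from `p` to `p ++ [e]` for every event `e` enabled in the
state `stateAt p` whose received values are those that `τ` has at this point. Since `⊤ + ⊤ = ⊤`,
this heap splits into any number of copies of itself, so every separating conjunct can receive all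
of it, and coinduction shows that it satisfies the specification (`Model.specPred_permHeap`). The
only token has to follow `τ`, and the clause that allows anything after a mispredicted input never
applies, because the heap predicts the inputs of `τ` itself. Hence every event of `τ` is enabled
after its predecessors (`Model.enabled_of_mem_ioSpec_Tr`).

For the simulation, `factClass` forgets buffering and passes to classes modulo `E`. A model state
represents the pooled facts of all components if the linear classes agree with multiplicity and the
persistent classes are present (`Simulates`). A role rule or an ordinary environment rule is matched
by the rule it comes from (`Simulates.fire`). A buffered input or output moves a fact between
components without changing its class, so the model stands still; the two halves of a setup rule
make up one silent application of that rule (`Simulates.sync`). Interface events cannot occur alone,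
since their labels lie in $\Lambda'$. The invariant `SystemInv` then gives equal nonempty labels and
valid equality checks, and uniqueness of fresh values carries over. -/

namespace ProtoImpl

noncomputable section

/-! ## Role states as functions of the history -/

section RoleBehavior

variable {T : TermSig.{u}} {n : ℕ} {P : ProtoSig.{u} n}

open Classical in
/-- The instantiation of the variables of a setup rule given by the arguments of its label. -/
def setupVal {r : Rule T P.base Var} {x : Var} (rid : Msg T)
    (z : {y : Var // y ∈ r.vars ∧ y ≠ x} → Msg T) : Var → Msg T :=
  fun y => if h : y ∈ r.vars ∧ y ≠ x then z ⟨y, h⟩ else rid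

open Classical in
/-- The state of a role after an event. -/
def nextState (S : Multiset (GFact T (extSig T P))) :
    SpecLabel T P → Multiset (GFact T (extSig T P))
  | .inl e => update e.inst.lhs e.inst.rhs S
  | .inr ⟨.buf i F, rid, z⟩ =>
      if F ∈ P.outS then update {bufFact i F rid z} 0 S else S + {bufFact i F rid z}
  | .inr ⟨.setup _ r _, rid, z⟩ => S + (r.rhs.map liftFact).map (Fact.subst (setupVal rid z))

/-- The state of a role after a sequence of events. -/
def stateAt (p : List (SpecLabel T P)) : Multiset (GFact T (extSig T P)) :=
  p.foldl nextState 0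

theorem stateAt_append (p : List (SpecLabel T P)) (e : SpecLabel T P) :
    stateAt (p ++ [e]) = nextState (stateAt p) e := by
  simp [stateAt]

/-- The events that role `i` with thread identifier `rid` may perform in the state `S`. -/
inductive Model.Enabled (R : Model T P) (E : EqTheory T) (res : EqRestriction P) (i : Fin n)
    (rid : T.Fresh) (S : Multiset (GFact T (extSig T P))) : SpecLabel T P → Prop
  | proto (r : Rule T P.base Var) (x : Var) (hr : r ∈ R.role i) (hx : IsRid i r x)
      (θ : Var → Msg T) (g : Rule T (extSig T P) Empty) (hθ : WellSorted θ)
      (hm : Matches g.lhs S) (hg : g.EqMod E ((bufferRule i x r).subst θ))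
      (hc : EqChecks E res g.act) :
      Enabled R E res i rid S (.inl ⟨bufferRule i x r, fun y => θ y, g⟩)
  | output (G : P.Env) (hG : G ∈ P.outS) (z : Fin (P.envArity G) → Msg T)
      (hz : bufFact i G (.fresh rid) z ∈ S) :
      Enabled R E res i rid S (.inr ⟨.buf i G, .fresh rid, z⟩)
  | input (F : P.Env) (hF : F ∈ P.inMinus) (z : Fin (P.envArity F) → Msg T) :
      Enabled R E res i rid S (.inr ⟨.buf i F, .fresh rid, z⟩)
  | setup (r : Rule T P.base Var) (x : Var) (h : R.IsSetup i r x)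
      (z : (SyncSym.setup (T := T) (P := P) i r x).Param → Msg T) :
      Enabled R E res i rid S (.inr ⟨.setup i r x, .fresh rid, z⟩)

theorem not_mem_outS_of_mem_inS {F : P.Env} (h : F ∈ P.inS) : F ∉ P.outS :=
  fun h' => Set.disjoint_left.1 P.in_out_disjoint h h'

open Classical in
/-- The values received by the input operation `q` after the history `p`, as predicted by `τ`. -/
def oracle (rid : T.Fresh) (τ p : List (SpecLabel T P)) (q : SyncSym T P) : q.Param → Msg T :=
  if h : ∃ z : q.Param → Msg T, ∃ m ρ, τ = p ++ .inr ⟨q, m, z⟩ :: ρ then h.choose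
  -- Arbitrary value: the prediction matters only where `τ` itself continues `p` by the operation
  -- `q`.
  else fun _ => .fresh rid

/-- The event of `τ` that follows `p` is determined by `τ` and `p`, so the choice in `oracle` has
only one candidate. -/
theorem oracle_eq (rid : T.Fresh) {τ p ρ : List (SpecLabel T P)} {q : SyncSym T P} {m : Msg T}
    {z : q.Param → Msg T} (h : τ = p ++ .inr ⟨q, m, z⟩ :: ρ) : oracle rid τ p q = z := by
  have hex : ∃ z : q.Param → Msg T, ∃ m ρ, τ = p ++ .inr ⟨q, m, z⟩ :: ρ := ⟨z, m, ρ, h⟩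
  rw [oracle, dif_pos hex]
  obtain ⟨m', ρ', h'⟩ := hex.choose_spec
  generalize hex.choose = z' at h'
  rw [h] at h'
  have := (List.cons.inj (List.append_cancel_left h')).1
  cases this
  rfl

/-! ## A heap that permits exactly the role's behavior -/

/-- Input events agree with the predictions of `τ`. -/
def Predicted (rid : T.Fresh) (τ p : List (SpecLabel T P)) (e : SpecLabel T P) : Prop :=
  ∀ (q : SyncSym T P) (m : Msg T) (z : q.Param → Msg T), q.IsInput → e = .inr ⟨q, m, z⟩ →
    z = oracle rid τ p q

open Classical in
/-- Unlimited permissions for all events enabled after a history, where the inputs are those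
predicted by `τ`. -/
def Model.permHeap (R : Model T P) (E : EqTheory T) (res : EqRestriction P) (i : Fin n)
    (rid : T.Fresh) (τ : List (SpecLabel T P)) : Heap T P
  | .token _ => 0
  | .perm p e p' =>
      if p' = p ++ [e] ∧ R.Enabled E res i rid (stateAt p) e ∧ Predicted rid τ p e then ⊤ else 0

variable (R : Model T P) (E : EqTheory T) (res : EqRestriction P) (i : Fin n) (rid : T.Fresh)
  (τ : List (SpecLabel T P))

/-- All multiplicities are `0` or `⊤`, which are idempotent. This makes separation harmless: the
heap can be given in full to every conjunct. -/
theorem Model.permHeap_add_self :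
    R.permHeap E res i rid τ + R.permHeap E res i rid τ = R.permHeap E res i rid τ := by
  funext c
  cases c with
  | token p => simp [permHeap]
  | perm p e p' =>
    simp only [permHeap, Pi.add_apply]
    split_ifs <;> simp

theorem Model.sum_permHeap_le {ι : Type v} (s : Finset ι) :
    ∑ _k ∈ s, R.permHeap E res i rid τ ≤ R.permHeap E res i rid τ := by
  classical
  induction s using Finset.induction_on with
  | empty => simp only [Finset.sum_empty]; exact fun c => zero_le
  | insert a s ha ih =>
    rw [Finset.sum_insert ha]
    exact (add_le_add le_rfl ih).trans (R.permHeap_add_self E res i rid τ).le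

variable {E res i rid τ} {R}

theorem Model.chunk_sep_permHeap {p : Place T P} {e : SpecLabel T P}
    (he : R.Enabled E res i rid (stateAt p) e) (hp : Predicted rid τ p e) {φ : Assertion T P}
    (hφ : φ (R.permHeap E res i rid τ)) :
    ((Assertion.chunk (.perm p e (p ++ [e]))).sep φ) (R.permHeap E res i rid τ) := by
  refine ⟨_, _, (R.permHeap_add_self E res i rid τ).le, ?_, hφ⟩
  simp [Assertion.chunk, permHeap, he, hp]

/-- Coinduction with the post-fixed point `X` that pairs each place, read as a history, with the
state reached by that history and with this one heap. -/
theorem Model.specPred_permHeap (p : Place T P) :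
    R.specPred E res i rid p (stateAt p) (R.permHeap E res i rid τ) := by
  let X : Place T P → Multiset (GFact T (extSig T P)) → Assertion T P :=
    fun p S h => S = stateAt p ∧ R.permHeap E res i rid τ = h
  have hX : X ≤ R.specBody E res i rid X := by
    rintro p S h ⟨rfl, rfl⟩
    refine ⟨fun _ => R.permHeap E res i rid τ, R.sum_permHeap_le E res i rid τ, fun k => ?_⟩
    have key : ∀ {e : SpecLabel T P} {S'}, R.Enabled E res i rid (stateAt p) e →
        Predicted rid τ p e → S' = nextState (stateAt p) e →
        ((Assertion.chunk (.perm p e (p ++ [e]))).sep (X (p ++ [e]) S'))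
          (R.permHeap E res i rid τ) := fun he hp hS =>
      chunk_sep_permHeap he hp ⟨by rw [hS, stateAt_append], rfl⟩
    cases k with
    | proto r x hr hx =>
      intro θ g hθ _ hm hg hc
      refine ⟨_, key (.proto r x hr hx θ g hθ hm hg hc) ?_ rfl⟩
      intro q m z _ h
      cases h
    | output G hG =>
      intro z hz
      refine ⟨_, key (.output G hG z hz) ?_ ?_⟩
      · intro q m z' hq h
        cases h
        exact absurd hG (not_mem_outS_of_mem_inS hq)
      · simp [nextState, hG]
    | input F hF =>
      -- The existential over received values is where the heap makes its prediction, so the oracle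
      -- is the witness.
      refine ⟨_, oracle rid τ p (.buf i F), key (.input F hF _) ?_ ?_⟩
      · intro q m z' hq h
        cases h
        rfl
      · simp [nextState, not_mem_outS_of_mem_inS hF.1]
    | setup r x hr =>
      let z := oracle rid τ p (.setup i r x)
      have hz : (fun y : {y : Var // y ∈ r.vars ∧ y ≠ x} => setupVal (.fresh rid) z y.1) = z := by
        funext y
        simp [setupVal, y.2]
      -- `setupVal` sends `x` to the thread identifier and the other variables of the rule to their
      -- predicted values.
      refine ⟨_, setupVal (.fresh rid) z, ?_, key (.setup r x hr _) ?_ ?_⟩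
      · simp [setupVal]
      · intro q m z' hq h
        cases h
        exact hz
      · exact congrArg (fun z' => stateAt p +
          (r.rhs.map liftFact).map (Fact.subst (setupVal (.fresh rid) z'))) hz.symm
  exact OrderHom.le_gfp _ hX p _ _ ⟨rfl, rfl⟩

/-- Comparing multiplicities: `permHeap` has no tokens, so the consumed token is the given one, and
the consumed permission has nonzero multiplicity. Removing one copy from infinitely many leaves
`permHeap` unchanged, so the situation reproduces itself after each step. -/
theorem Heap.remove_token_perm {p p₀ p' : Place T P} {e : SpecLabel T P} {h : Heap T P}
    (hh : h + Heap.single (.token p₀) + Heap.single (.perm p₀ e p') =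
      Heap.single (.token p) + R.permHeap E res i rid τ) :
    p₀ = p ∧ p' = p ++ [e] ∧ R.Enabled E res i rid (stateAt p) e ∧ Predicted rid τ p e ∧
      h = R.permHeap E res i rid τ := by
  classical
  have hp : p₀ = p := by
    by_contra hne
    have := congrFun hh (.token p₀)
    simp [Heap.single, Model.permHeap, hne] at this
  subst hp
  have hperm := congrFun hh (.perm p₀ e p')
  have hc : p' = p₀ ++ [e] ∧ R.Enabled E res i rid (stateAt p₀) e ∧ Predicted rid τ p₀ e := by
    by_contra hne
    simp [Heap.single, Model.permHeap, hne] at hperm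
  refine ⟨rfl, hc.1, hc.2.1, hc.2.2, ?_⟩
  funext c
  have hc' := congrFun hh c
  cases c with
  | token a =>
    simp only [Pi.add_apply, Heap.single, Model.permHeap, Chunk.token.injEq, reduceCtorEq,
      if_false, add_zero] at hc' ⊢
    split_ifs at hc' with ha
    · exact (ENat.add_left_injective_of_ne_top (by simp : (1 : ℕ∞) ≠ ⊤))
        (by simpa using hc')
    · simpa using hc'
  | perm a b c =>
    simp only [Pi.add_apply, Heap.single, Model.permHeap, Chunk.perm.injEq, reduceCtorEq,
      if_false, add_zero, zero_add] at hc' ⊢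
    -- At the consumed permission the equation reads `h _ + 1 = ⊤`, which forces `⊤`.
    by_cases hab : a = p₀ ∧ b = e ∧ c = p'
    · obtain ⟨rfl, rfl, rfl⟩ := hab
      simpa [hc] using hc'
    · simpa [hab] using hc'

/-- Induction on the production; the heap always consists of `permHeap` and one token, placed at the
prefix `p` of `τ` performed so far. -/
theorem Heap.Produces.enabled {h : Heap T P} {ρ : List (SpecLabel T P)} (hρ : h.Produces ρ) :
    ∀ p : Place T P, h = Heap.single (.token p) + R.permHeap E res i rid τ → τ = p ++ ρ →
      ∀ a e b, ρ = a ++ e :: b → R.Enabled E res i rid (stateAt (p ++ a)) e := by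
  induction hρ with
  | nil h => intro _ _ _ a e b hab; simp at hab
  | step h p₀ p' e₀ ρ _ ih =>
    intro p hh hτ a e b hab
    obtain ⟨rfl, rfl, he, -, rfl⟩ := Heap.remove_token_perm hh
    cases a with
    | nil =>
      obtain ⟨rfl, -⟩ := List.cons.inj hab
      simpa using he
    | cons c a =>
      obtain ⟨rfl, hρ⟩ := List.cons.inj hab
      have := ih (p₀ ++ [e₀]) (add_comm _ _) (by simpa using hτ) a e b hρ
      simpa using this
  | contradict h p₀ p' q hq m z z' hz ρ =>
    intro p hh hτ
    -- The heap's value `z` and the value `z'` in the trace both equal the oracle's, so no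
    -- misprediction can occur.
    obtain ⟨rfl, -, -, hpred, -⟩ := Heap.remove_token_perm hh
    exact absurd ((hpred q m z hq rfl).trans (oracle_eq rid hτ)) hz

/-- All events in the traces of the specification are enabled. -/
theorem Model.enabled_of_mem_ioSpec_Tr (hτ : τ ∈ (R.ioSpec E res i rid).Tr)
    {a b : List (SpecLabel T P)} {e : SpecLabel T P} (h : τ = a ++ e :: b) :
    R.Enabled E res i rid (stateAt a) e := by
  -- Membership in `Tr` concerns all heap models, so it may be tested on the heap built from `τ`
  -- itself.
  refine (hτ (Heap.single (.token []) + R.permHeap E res i rid τ) ?_).enabled [] rfl rfl a e b h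
  refine ⟨[], _, _, le_rfl, ?_, R.specPred_permHeap []⟩
  simp [Assertion.chunk, Heap.single]

end RoleBehavior

/-! ## Facts modulo buffering and equality -/

section FactClasses

theorem EqMod.subst {T : TermSig.{u}} {E : EqTheory T} {V : Type} {σ θ : V → Msg T}
    (t : Term T V) (h : ∀ y ∈ t.vars, EqMod E (σ y) (θ y)) :
    EqMod E (t.subst σ) (t.subst θ) := by
  induction t with
  | fresh a => exact .refl _
  | pub a => exact .refl _
  | var x => exact h x rfl
  | app f ts ih =>
    exact .congr f _ _ fun j => ih j fun y hy => h y (Set.mem_iUnion.2 ⟨j, hy⟩)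

theorem Fact.EqMod.equivalence {T : TermSig.{u}} {F : FactSig.{u}} (E : EqTheory T) :
    Equivalence (Fact.EqMod E (F := F)) where
  refl f := .mk f.sym _ _ fun _ => .refl _
  symm h := by
    obtain ⟨s, ts, us, h⟩ := h
    exact .mk s _ _ fun j => (h j).symm
  trans h h' := by
    obtain ⟨s, ts, us, h⟩ := h
    obtain ⟨_, _, vs, h'⟩ := h'
    exact .mk s _ _ fun j => (h j).trans (h' j)

variable {T : TermSig.{u}} {n : ℕ} {P : ProtoSig.{u} n} {E : EqTheory T}

/-- Facts of the model modulo `E`. -/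
def factSetoid (T : TermSig.{u}) {n : ℕ} (P : ProtoSig.{u} n) (E : EqTheory T) :
    Setoid (GFact T P.base) :=
  ⟨Fact.EqMod E, Fact.EqMod.equivalence E⟩

abbrev FactClass (T : TermSig.{u}) {n : ℕ} (P : ProtoSig.{u} n) (E : EqTheory T) : Type u :=
  Option (Quotient (factSetoid T P E))

/-- The fact of the model, modulo `E`, that a component fact stands for: buffered facts stand for
the original ones. -/
def factClass (E : EqTheory T) : GFact T (extSig T P) → FactClass T P E
  | ⟨.base s, t⟩ => some (Quotient.mk (factSetoid T P E) ⟨s, t⟩)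
  | ⟨.buf _ F, t⟩ =>
      some (Quotient.mk (factSetoid T P E) ⟨.env F, fun j => t (some j)⟩)
  | ⟨.sync _, _⟩ => none

theorem factClass_liftFact_eq_iff {f f' : GFact T P.base} :
    factClass E (liftFact f) = factClass E (liftFact f') ↔ Fact.EqMod E f f' :=
  ⟨fun h => Quotient.exact (s := factSetoid T P E) (Option.some.inj h),
    fun h => congrArg some (Quotient.sound (s := factSetoid T P E) h)⟩

theorem factClass_eq_of_eqMod {f f' : GFact T (extSig T P)} (h : Fact.EqMod E f f') :
    factClass E f = factClass E f' := by
  obtain ⟨s, ts, us, h⟩ := h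
  cases s with
  | base s =>
    exact congrArg some (Quotient.sound (s := factSetoid T P E)
      (Fact.EqMod.mk (F := P.base) s ts us h))
  | buf i F =>
    exact congrArg some (Quotient.sound (s := factSetoid T P E)
      (Fact.EqMod.mk (F := P.base) (.env F) _ _ fun j => h (some j)))
  | sync q => rfl

/-- The class consists of persistent facts. -/
def FactClass.Pers : FactClass T P E → Prop
  | some c => Quotient.lift (s := factSetoid T P E) (fun f => P.base.Pers f.sym)
      (by rintro _ _ ⟨s, ts, us, h⟩; rfl) c
  | none => False

theorem factClass_pers (f : GFact T (extSig T P)) :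
    (factClass E f).Pers ↔ (extSig T P).Pers f.sym := by
  obtain ⟨s, t⟩ := f
  cases s <;> exact Iff.rfl

theorem factClass_liftFact_pers (f : GFact T P.base) :
    (factClass E (liftFact f)).Pers ↔ P.base.Pers f.sym :=
  Iff.rfl

open Classical in
/-- The linear classes. -/
def linClasses (m : Multiset (FactClass T P E)) : Multiset (FactClass T P E) :=
  m.filter (fun c => ¬ c.Pers)

open Classical in
theorem linClasses_add (m m' : Multiset (FactClass T P E)) :
    linClasses (m + m') = linClasses m + linClasses m' :=
  Multiset.filter_add _ _ _

open Classical in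
theorem map_linPart (S : Multiset (GFact T (extSig T P))) :
    (linPart S).map (factClass E) = linClasses (S.map (factClass E)) := by
  rw [linPart, linClasses, Multiset.filter_map]
  exact congrArg _ (Multiset.filter_congr fun f _ => (factClass_pers f).not.symm)

open Classical in
theorem map_linPart_base (S : Multiset (GFact T P.base)) :
    (linPart S).map (fun f => factClass E (liftFact f)) =
      linClasses (S.map fun f => factClass E (liftFact f)) := by
  rw [linPart, linClasses, Multiset.filter_map]
  exact congrArg _ (Multiset.filter_congr fun f _ => (factClass_liftFact_pers f).not.symm)

/-! ### Linear parts, matching and state updates. -/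

open Classical in
theorem linPart_add {F : FactSig.{u}} (l l' : Multiset (GFact T F)) :
    linPart (l + l') = linPart l + linPart l' :=
  Multiset.filter_add _ _ _

open Classical in
theorem linPart_le {F : FactSig.{u}} (l : Multiset (GFact T F)) : linPart l ≤ l :=
  Multiset.filter_le _ _

open Classical in
theorem linPart_linPart {F : FactSig.{u}} (l : Multiset (GFact T F)) :
    linPart (linPart l) = linPart l := by
  simp [linPart, Multiset.filter_filter]

open Classical in
theorem linPart_zero {F : FactSig.{u}} : linPart (0 : Multiset (GFact T F)) = 0 :=
  Multiset.filter_zero _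

open Classical in
theorem linPart_eq_zero {F : FactSig.{u}} {l : Multiset (GFact T F)}
    (h : ∀ f ∈ l, F.Pers f.sym) : linPart l = 0 := by
  simpa [linPart, Multiset.filter_eq_nil] using h

open Classical in
theorem not_pers_of_mem_linPart {F : FactSig.{u}} {l : Multiset (GFact T F)} {f : GFact T F}
    (h : f ∈ linPart l) : ¬ F.Pers f.sym :=
  (Multiset.mem_filter.1 h).2

theorem update_linPart_add {F : FactSig.{u}} (l r c : Multiset (GFact T F)) :
    update l r (linPart l + c) = c + r := by
  classical
  simp [update]

theorem update_add_right {F : FactSig.{u}} {l S : Multiset (GFact T F)} (h : linPart l ≤ S)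
    (r S' : Multiset (GFact T F)) : update l r (S + S') = update l r S + S' := by
  obtain ⟨c, rfl⟩ := Multiset.le_iff_exists_add.1 h
  rw [add_assoc, update_linPart_add, update_linPart_add]
  abel

theorem update_zero_left {F : FactSig.{u}} (r S : Multiset (GFact T F)) :
    update 0 r S = S + r := by
  classical
  simp [update, linPart_zero]

theorem update_zero_add {F : FactSig.{u}} (l r S : Multiset (GFact T F)) :
    update l 0 S + r = update l r S := by
  simp [update]

theorem Matches.mono {F : FactSig.{u}} {l S S' : Multiset (GFact T F)} (h : Matches l S)
    (hS : S ≤ S') : Matches l S' :=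
  ⟨h.1.trans hS, fun f hf hp => Multiset.mem_of_le hS (h.2 f hf hp)⟩

theorem Matches.singleton {F : FactSig.{u}} {f : GFact T F} {S : Multiset (GFact T F)}
    (h : f ∈ S) : Matches {f} S :=
  ⟨(linPart_le _).trans (Multiset.singleton_le.2 h), fun g hg _ => by
    rwa [Multiset.mem_singleton.1 hg]⟩

/-- Trades matching modulo `E` for an equality of multisets of classes, to which cancellation and
filtering apply. -/
theorem rel_eqMod_iff {s t : Multiset (GFact T P.base)} :
    Multiset.Rel (Fact.EqMod E) s t ↔ (s.map fun f => factClass E (liftFact f)) =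
      t.map fun f => factClass E (liftFact f) := by
  rw [← Multiset.rel_eq, Multiset.rel_map]
  simp only [factClass_liftFact_eq_iff]

theorem map_factClass_eq {s t : Multiset (GFact T (extSig T P))}
    (h : Multiset.Rel (Fact.EqMod E) s t) : s.map (factClass E) = t.map (factClass E) := by
  rw [← Multiset.rel_eq, Multiset.rel_map]
  exact h.mono fun _ _ _ _ h => factClass_eq_of_eqMod h

/-- Equality modulo `E` keeps fact symbols, so whatever equals a lifted multiset is itself lifted.
-/
theorem exists_eq_map_liftFact {s : Multiset (GFact T (extSig T P))}
    {t : Multiset (GFact T P.base)} (h : Multiset.Rel (Fact.EqMod E) s (t.map liftFact)) :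
    ∃ s₀ : Multiset (GFact T P.base), s = s₀.map liftFact ∧ Multiset.Rel (Fact.EqMod E) s₀ t := by
  induction t using Multiset.induction_on generalizing s with
  | empty =>
    rw [Multiset.map_zero, Multiset.rel_zero_right] at h
    exact ⟨0, by simpa using h, .zero⟩
  | cons a t ih =>
    rw [Multiset.map_cons, Multiset.rel_cons_right] at h
    obtain ⟨f, s', hf, hs', rfl⟩ := h
    obtain ⟨s₀, rfl, hs₀⟩ := ih hs'
    obtain ⟨f₀, rfl, hf₀⟩ : ∃ f₀ : GFact T P.base, f = liftFact f₀ ∧ Fact.EqMod E f₀ a := by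
      generalize hb : liftFact a = b at hf
      obtain ⟨s, ts, us, h⟩ := hf
      obtain ⟨c, vs⟩ := a
      cases hb
      exact ⟨⟨c, ts⟩, rfl, .mk c ts vs h⟩
    exact ⟨f₀ ::ₘ s₀, by simp, .cons hf₀ hs₀⟩

theorem map_subst_map_liftFact {V W : Type} (θ : V → Term T W) (s : Multiset (Fact T P.base V)) :
    (s.map liftFact).map (Fact.subst θ) = (s.map (Fact.subst θ)).map liftFact := by
  simp only [Multiset.map_map]
  rfl

theorem factClass_subst_bufferFact (i : Fin n) (x : Var) (θ : Var → Msg T)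
    (f : Fact T P.base Var) :
    factClass E ((bufferFact i x f).subst θ) = factClass E (liftFact (f.subst θ)) := by
  obtain ⟨s, t⟩ := f
  cases s with
  | act a => rfl
  | env F =>
    unfold bufferFact
    dsimp only
    split_ifs <;> rfl
  | st i s => rfl

theorem map_factClass_bufferFact (i : Fin n) (x : Var) (θ : Var → Msg T)
    (s : Multiset (Fact T P.base Var)) :
    ((s.map (bufferFact i x)).map (Fact.subst θ)).map (factClass E) =
      (s.map (Fact.subst θ)).map fun f => factClass E (liftFact f) := by
  simp only [Multiset.map_map, Function.comp_def, factClass_subst_bufferFact]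

end FactClasses

/-! ## Simulation of component states by model states -/

section Simulation

theorem exists_le_of_le_map {α β : Type*} {f : α → β} {s : Multiset β} {t : Multiset α}
    (h : s ≤ t.map f) : ∃ t' ≤ t, t'.map f = s := by
  obtain ⟨c, hc⟩ := Multiset.le_iff_exists_add.1 h
  have hrel : Multiset.Rel (fun b a => b = f a) (s + c) t := by
    rw [← hc, Multiset.rel_map_left]
    exact Multiset.rel_refl_of_refl_on fun _ _ => rfl
  obtain ⟨t₀, t₁, h₀, -, rfl⟩ := Multiset.rel_add_left.1 hrel
  refine ⟨t₀, Multiset.le_add_right _ _, ?_⟩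
  rw [← Multiset.rel_eq, Multiset.rel_map_left]
  exact (Multiset.rel_flip.2 h₀).mono fun _ _ _ _ h => h.symm

theorem exists_map_eq_of_forall_mem {α β : Type*} {f : α → β} {s : Multiset β} {t : Multiset α}
    (h : ∀ b ∈ s, b ∈ t.map f) : ∃ t' : Multiset α, t'.map f = s ∧ ∀ a ∈ t', a ∈ t := by
  induction s using Multiset.induction_on with
  | empty => exact ⟨0, by simp⟩
  | cons b s ih =>
    obtain ⟨t', rfl, ht'⟩ := ih fun b hb => h b (Multiset.mem_cons_of_mem hb)
    obtain ⟨a, ha, rfl⟩ := Multiset.mem_map.1 (h b (Multiset.mem_cons_self _ _))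
    exact ⟨a ::ₘ t', by simp, by simpa [ha] using ht'⟩

variable {T : TermSig.{u}} {n : ℕ} {P : ProtoSig.{u} n} {E : EqTheory T}

/-- The state `S` of the model represents the facts `tot` of all components. -/
structure Simulates (E : EqTheory T) (S : Multiset (GFact T P.base))
    (tot : Multiset (GFact T (extSig T P))) : Prop where
  lin : linClasses (S.map fun f => factClass E (liftFact f)) = linClasses (tot.map (factClass E))
  pers : ∀ f ∈ tot, (extSig T P).Pers f.sym → factClass E f ∈ S.map fun f => factClass E (liftFact f)

variable {S : Multiset (GFact T P.base)} {l r tot : Multiset (GFact T (extSig T P))}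

/-- The linear facts of `l` are represented by a submultiset of the linear part of `S`, since the
linear classes agree. Each persistent fact only needs some representative in `S`, which may be
reused. -/
theorem Simulates.exists_matches (h : Simulates E S tot) (hl : Matches l tot) :
    ∃ l' : Multiset (GFact T P.base), Matches l' S ∧
      (l'.map fun f => factClass E (liftFact f)) = l.map (factClass E) := by
  classical
  obtain ⟨N, hN, hNl⟩ : ∃ N ≤ linPart S, (N.map fun f => factClass E (liftFact f)) =
      (linPart l).map (factClass E) := by
    apply exists_le_of_le_map
    rw [map_linPart_base, h.lin, ← map_linPart, ← linPart_linPart]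
    exact Multiset.map_le_map (Multiset.filter_le_filter _ hl.1)
  obtain ⟨M, hM, hMS⟩ := exists_map_eq_of_forall_mem (f := fun f => factClass E (liftFact f))
    (s := (l.filter fun f => (extSig T P).Pers f.sym).map (factClass E)) (t := S) (by
      intro b hb
      obtain ⟨f, hf, rfl⟩ := Multiset.mem_map.1 hb
      obtain ⟨hf, hp⟩ := Multiset.mem_filter.1 hf
      exact h.pers f (hl.2 f hf hp) hp)
  have hMp : ∀ f ∈ M, P.base.Pers f.sym := by
    intro f hf
    have : factClass E (liftFact f) ∈
        (l.filter fun f => (extSig T P).Pers f.sym).map (factClass E) :=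
      hM ▸ Multiset.mem_map_of_mem _ hf
    obtain ⟨f', hf', he⟩ := Multiset.mem_map.1 this
    rw [← factClass_liftFact_pers (E := E), ← he, factClass_pers]
    exact (Multiset.mem_filter.1 hf').2
  have hNN : linPart N = N :=
    Multiset.filter_eq_self.2 fun f hf => not_pers_of_mem_linPart (Multiset.mem_of_le hN hf)
  refine ⟨N + M, ⟨?_, ?_⟩, ?_⟩
  · rw [linPart_add, linPart_eq_zero hMp, add_zero, hNN]
    exact hN.trans (linPart_le S)
  · intro f hf _
    rcases Multiset.mem_add.1 hf with hf | hf
    · exact Multiset.mem_of_le (hN.trans (linPart_le S)) hf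
    · exact hMS f hf
  · rw [Multiset.map_add, hNl, hM, ← Multiset.map_add]
    congr 1
    rw [add_comm]
    exact Multiset.filter_add_not (fun f => (extSig T P).Pers f.sym) l

/-- The consumed linear parts have the same classes, so they cancel from the equation of linear
classes; equal classes are then added on both sides. -/
theorem Simulates.update (h : Simulates E S tot) (hl : Matches l tot)
    {l' r' : Multiset (GFact T P.base)} (hl' : Matches l' S)
    (hll : (l'.map fun f => factClass E (liftFact f)) = l.map (factClass E))
    (hrr : (r'.map fun f => factClass E (liftFact f)) = r.map (factClass E)) :
    Simulates E (ProtoImpl.update l' r' S) (ProtoImpl.update l r tot) := by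
  obtain ⟨c, rfl⟩ := Multiset.le_iff_exists_add.1 hl.1
  obtain ⟨d, rfl⟩ := Multiset.le_iff_exists_add.1 hl'.1
  have hlin := h.lin
  rw [Multiset.map_add, Multiset.map_add, linClasses_add, linClasses_add, map_linPart,
    map_linPart_base, hll] at hlin
  rw [update_linPart_add, update_linPart_add]
  refine ⟨?_, ?_⟩
  · rw [Multiset.map_add, Multiset.map_add, linClasses_add, linClasses_add, hrr,
      add_left_cancel hlin]
  · intro f hf hp
    rw [Multiset.map_add, Multiset.mem_add]
    rcases Multiset.mem_add.1 hf with hf | hf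
    · have := h.pers f (Multiset.mem_add.2 (.inr hf)) hp
      rw [Multiset.map_add, Multiset.mem_add] at this
      -- A persistent class has no representative among the consumed linear facts, so its
      -- representative survives.
      refine .inl (this.resolve_left fun hmem => ?_)
      obtain ⟨f', hf', he⟩ := Multiset.mem_map.1 hmem
      refine not_pers_of_mem_linPart hf' ?_
      rwa [← factClass_liftFact_pers (E := E), he, factClass_pers]
    · exact .inr (hrr ▸ Multiset.mem_map_of_mem _ hf)

/-- Moving facts between components does not affect the simulating state. -/
theorem Simulates.move (h : Simulates E S tot) (hl : Matches l tot)
    (hlr : l.map (factClass E) = r.map (factClass E)) :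
    Simulates E S (ProtoImpl.update l r tot) := by
  have hl' := hl
  obtain ⟨c, rfl⟩ := Multiset.le_iff_exists_add.1 hl.1
  rw [update_linPart_add]
  refine ⟨?_, ?_⟩
  · have hll := congrArg (Multiset.map (factClass E)) (linPart_linPart l)
    rw [map_linPart, map_linPart] at hll
    rw [h.lin, Multiset.map_add, Multiset.map_add, linClasses_add, linClasses_add, map_linPart,
      ← hlr, add_comm, ← map_linPart, hll]
  · intro f hf hp
    rcases Multiset.mem_add.1 hf with hf | hf
    · exact h.pers f (Multiset.mem_add.2 (.inr hf)) hp
    -- A persistent fact of `r` shares its class with a persistent fact of `l`, which was present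
    -- already.
    · obtain ⟨f', hf', he⟩ := Multiset.mem_map.1 (hlr ▸ Multiset.mem_map_of_mem (factClass E) hf)
      have hp' : (extSig T P).Pers f'.sym := by
        rwa [← factClass_pers (E := E), he, factClass_pers]
      exact he ▸ h.pers f' (hl'.2 f' hf' hp') hp'

/-- A component step by an instance of a rule is simulated by the rule. -/
theorem Simulates.fire (h : Simulates E S tot) (hl : Matches l tot)
    {rules : Set (Rule T P.base Var)} {rule : Rule T P.base Var} (hrule : rule ∈ rules)
    {θ : Var → Msg T} (hθ : WellSorted θ)
    (hlhs : l.map (factClass E) =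
      (rule.lhs.map (Fact.subst θ)).map fun f => factClass E (liftFact f))
    (hrhs : r.map (factClass E) =
      (rule.rhs.map (Fact.subst θ)).map fun f => factClass E (liftFact f))
    {a : Multiset (GFact T P.base)}
    (ha : Multiset.Rel (Fact.EqMod E) a (rule.act.map (Fact.subst θ))) :
    ∃ S' : Multiset (GFact T P.base), (msrLTS E (fun _ => True) rules).step S a S' ∧
      Simulates E S' (ProtoImpl.update l r tot) := by
  obtain ⟨l', hl', hll⟩ := h.exists_matches hl
  -- The left-hand side uses the representatives found in `S`, which match the instance only modulo
  -- `E`; the right-hand side can be the instance itself.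
  refine ⟨ProtoImpl.update l' (rule.rhs.map (Fact.subst θ)) S,
    ⟨rule, hrule, θ, hθ, ⟨l', a, rule.rhs.map (Fact.subst θ)⟩, ⟨?_, ha, ?_⟩, hl', trivial, rfl, rfl⟩,
    h.update hl hl' hll hrhs.symm⟩
  · exact rel_eqMod_iff.2 (hll.trans hlhs)
  · exact rel_eqMod_iff.2 rfl

end Simulation

/-! ## Synchronization labels -/

section SyncLabels

variable {T : TermSig.{u}} {n : ℕ} {P : ProtoSig.{u} n} {E : EqTheory T}

theorem syncFact_injective {q q' : SyncSym T P} {m m' : Msg T} {z : q.Param → Msg T}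
    {z' : q'.Param → Msg T} (h : syncFact q m z = syncFact q' m' z') :
    (⟨q, m, z⟩ : APerm T P) = ⟨q', m', z'⟩ := by
  obtain ⟨h₁, h₂⟩ := Fact.mk.inj h
  cases h₁
  have h₃ := eq_of_heq h₂
  have hm : m = m' := congrFun h₃ none
  have hz : z = z' := funext fun j => congrFun h₃ (some j)
  rw [hm, hz]

theorem eqMod_syncFact {f : GFact T (extSig T P)} {q : SyncSym T P} {m : Msg T}
    {z : q.Param → Msg T} (h : Fact.EqMod E f (syncFact q m z)) :
    ∃ m' z', f = syncFact q m' z' ∧ EqMod E m' m ∧ ∀ j, EqMod E (z' j) (z j) := by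
  generalize hb : syncFact q m z = b at h
  obtain ⟨s, ts, us, h⟩ := h
  cases hb
  refine ⟨ts none, fun j => ts (some j), ?_, h none, fun j => h (some j)⟩
  refine congrArg (Fact.mk (F := extSig T P) (ExtSym.sync q)) ?_
  funext o
  cases o <;> rfl

theorem eqMod_extEnvFact {f : GFact T (extSig T P)} {F : P.Env}
    {t : Fin (P.envArity F) → Msg T} (h : Fact.EqMod E f (extEnvFact F t)) :
    ∃ t', f = extEnvFact F t' ∧ ∀ j, EqMod E (t' j) (t j) := by
  generalize hb : extEnvFact F t = b at h
  obtain ⟨s, ts, us, h⟩ := h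
  cases hb
  exact ⟨ts, rfl, h⟩

theorem rel_singleton_right {α β : Type*} {ρ : α → β → Prop} {s : Multiset α} {b : β}
    (h : Multiset.Rel ρ s {b}) : ∃ a, s = {a} ∧ ρ a b := by
  obtain ⟨a, s', ha, hs', rfl⟩ := Multiset.rel_cons_right.1 h
  rw [Multiset.rel_zero_right] at hs'
  exact ⟨a, by rw [hs']; rfl, ha⟩

theorem map_liftFact_ne_syncFact (s : Multiset (GFact T P.base)) (q : SyncSym T P) (m : Msg T)
    (z : q.Param → Msg T) : s.map liftFact ≠ {syncFact q m z} := by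
  intro h
  have : syncFact q m z ∈ s.map liftFact := h ▸ Multiset.mem_singleton_self _
  obtain ⟨f, -, hf⟩ := Multiset.mem_map.1 this
  cases (Fact.mk.inj hf).1

/-- The interface operations of the model. -/
def Model.IsOp (R : Model T P) : SyncSym T P → Prop
  | .buf _ F => F ∈ P.inMinus ∪ P.outS
  | .setup i r x => R.IsSetup i r x

theorem subst_syncFact {V W : Type} (θ : V → Term T W) (q : SyncSym T P) (m : Term T V)
    (z : q.Param → Term T V) :
    (syncFact q m z).subst θ = syncFact q (m.subst θ) fun j => (z j).subst θ := by
  refine congrArg (Fact.mk (F := extSig T P) (ExtSym.sync q)) ?_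
  funext o
  cases o <;> rfl

theorem subst_bufLabel (θ : Var → Msg T) (i : Fin n) (F : P.Env) :
    (bufLabel T i F).subst θ = syncFact (.buf i F) (θ ridVar) fun j => θ (msgVar j.1) :=
  subst_syncFact θ (.buf i F) (.var ridVar) (argVars F)

theorem subst_setupLabel (θ : Var → Msg T) (i : Fin n) (r : Rule T P.base Var) (x : Var) :
    (setupLabel i r x).subst θ = syncFact (.setup i r x) (θ x) fun y => θ y.1 :=
  subst_syncFact θ (.setup i r x) (.var x) fun y => .var y.1

theorem Model.IsOp.mem_syncLabels {R : Model T P} {q : SyncSym T P} (hq : R.IsOp q) (m : Msg T)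
    (z : q.Param → Msg T) : {syncFact q m z} ∈ R.syncLabels := by
  cases q with
  | buf i F =>
    -- The default `m` also serves `ridVar`, which has sort fresh. This `θ` need not respect sorts,
    -- and `syncLabels` does not ask for it.
    let θ : Var → Msg T := fun y => match y with
      | ⟨.msg, j⟩ => if h : j < P.envArity F then z ⟨j, h⟩ else m
      | _ => m
    have hθ : (bufLabel T i F).subst θ = syncFact (.buf i F) m z := by
      rw [subst_bufLabel]
      refine congrArg (syncFact (.buf i F) m) (funext fun j => ?_)
      exact dif_pos j.2
    rcases hq with hF | hF
    · exact ⟨i, _, .input F hF, θ, by simp [Rule.subst, hθ]⟩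
    · exact ⟨i, _, .output F hF, θ, by simp [Rule.subst, hθ]⟩
  | setup i r x =>
    refine ⟨i, _, .setup r x hq, setupVal m z, ?_⟩
    have hθ : (setupLabel i r x).subst (setupVal m z) = syncFact (.setup i r x) m z := by
      rw [subst_setupLabel, show setupVal m z x = m by simp [setupVal]]
      exact congrArg (syncFact (.setup i r x) m) (funext fun j => dif_pos j.2)
    simp [Rule.subst, hθ]

theorem exists_eq_singleton_of_mem_syncLabels {R : Model T P}
    {a : Multiset (GFact T (extSig T P))} (h : a ∈ R.syncLabels) :
    ∃ q m z, a = {syncFact q m z} := by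
  obtain ⟨i, r', hr', θ, rfl⟩ := h
  cases hr' <;> simp only [Rule.subst, Multiset.map_singleton, subst_bufLabel, subst_setupLabel]
    <;> exact ⟨_, _, _, rfl⟩

theorem Model.EnvHalf.exists_act {R : Model T P} {r' : Rule T (extSig T P) Var} (h : R.EnvHalf r')
    {θ : Var → Msg T} {g : Rule T (extSig T P) Empty} (hg : g.EqMod E (r'.subst θ)) :
    ∃ q m z, g.act = {syncFact q m z} ∧ R.IsOp q := by
  obtain ⟨-, hact, -⟩ := hg
  cases h with
  | input i F hF =>
    obtain ⟨f, hf, hfe⟩ := rel_singleton_right hact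
    rw [subst_bufLabel] at hfe
    obtain ⟨m, z, rfl, -⟩ := eqMod_syncFact hfe
    exact ⟨_, m, z, hf, .inl hF⟩
  | output i F hF =>
    obtain ⟨f, hf, hfe⟩ := rel_singleton_right hact
    rw [subst_bufLabel] at hfe
    obtain ⟨m, z, rfl, -⟩ := eqMod_syncFact hfe
    exact ⟨_, m, z, hf, .inr hF⟩
  | setup i r x hr =>
    obtain ⟨f, hf, hfe⟩ := rel_singleton_right hact
    rw [subst_setupLabel] at hfe
    obtain ⟨m, z, rfl, -⟩ := eqMod_syncFact hfe
    exact ⟨_, m, z, hf, hr⟩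

theorem Model.Enabled.isOp {R : Model T P} {res : EqRestriction P} {i : Fin n} {rid : T.Fresh}
    {S : Multiset (GFact T (extSig T P))} {e : APerm T P}
    (h : R.Enabled E res i rid S (.inr e)) : R.IsOp e.op := by
  cases h with
  | output G hG z hz => exact .inr hG
  | input F hF z => exact .inl hF
  | setup r x hr z => exact hr

theorem factClass_bufFact_eq {i : Fin n} {F : P.Env} {m : Msg T}
    {t z : Fin (P.envArity F) → Msg T} (h : ∀ j, EqMod E (t j) (z j)) :
    factClass E (extEnvFact F t) = factClass E (bufFact i F m z) :=
  congrArg some (Quotient.sound (s := factSetoid T P E) (Fact.EqMod.mk (F := P.base) (.env F) _ _ h))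

/-- The two halves of an interface operation amount to at most one silent step of the model. -/
theorem Simulates.sync {R : Model T P} (hR : R.Format) {res : EqRestriction P} {i : Fin n}
    {rid : T.Fresh} {S : Multiset (GFact T P.base)}
    {env Q rest : Multiset (GFact T (extSig T P))} {e : APerm T P}
    (h : Simulates E S (env + (Q + rest))) (he : R.Enabled E res i rid Q (.inr e))
    {r' : Rule T (extSig T P) Var} (hr' : R.EnvHalf r') {θ : Var → Msg T} (hθ : WellSorted θ)
    {g : Rule T (extSig T P) Empty} (hg : g.EqMod E (r'.subst θ)) (hm : Matches g.lhs env)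
    (hact : g.act = {syncFact e.op e.rid e.arg}) :
    ∃ S' : Multiset (GFact T P.base),
      (S' = S ∨ (msrLTS E (fun _ => True) R.rules).step S 0 S') ∧
      Simulates E S' (ProtoImpl.update g.lhs g.rhs env + (nextState Q (.inr e) + rest)) := by
  obtain ⟨hlhs, ha, hrhs⟩ := hg
  obtain ⟨q, m, z⟩ := e
  cases hr' with
  | input j F hF =>
    rw [hact] at ha
    obtain ⟨f, hf, hfe⟩ := rel_singleton_right ha
    rw [subst_bufLabel] at hfe
    obtain ⟨m', z', rfl, -, hz⟩ := eqMod_syncFact hfe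
    cases syncFact_injective (Multiset.singleton_inj.1 hf)
    obtain ⟨f, hl, hfe⟩ := rel_singleton_right hlhs
    obtain ⟨t, rfl, ht⟩ := eqMod_extEnvFact (t := fun j => (argVars (T := T) F j).subst θ) hfe
    have hr : g.rhs = 0 := Multiset.rel_zero_right.1 hrhs
    refine ⟨S, .inl rfl, ?_⟩
    rw [hl] at hm
    have hns : nextState Q (.inr ⟨.buf j F, m, z⟩) = Q + {bufFact j F m z} := by
      simp [nextState, not_mem_outS_of_mem_inS hF.1]
    rw [hr, hl, hns]
    -- The environment loses `F(t)` and the role gains `F_i(m, z)`, two facts of the same class.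
    have := h.move (hm.mono (Multiset.le_add_right _ _)) (r := {bufFact j F m z}) (by
      rw [Multiset.map_singleton, Multiset.map_singleton,
        factClass_bufFact_eq fun j => (ht j).trans (hz j).symm])
    rw [update_add_right hm.1, ← update_zero_add] at this
    convert this using 1
    abel
  | output j F hF =>
    rw [hact] at ha
    obtain ⟨f, hf, hfe⟩ := rel_singleton_right ha
    rw [subst_bufLabel] at hfe
    obtain ⟨m', z', rfl, -, hz⟩ := eqMod_syncFact hfe
    cases syncFact_injective (Multiset.singleton_inj.1 hf)
    obtain ⟨f, hr, hfe⟩ := rel_singleton_right hrhs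
    obtain ⟨t, rfl, ht⟩ := eqMod_extEnvFact (t := fun j => (argVars (T := T) F j).subst θ) hfe
    have hl : g.lhs = 0 := Multiset.rel_zero_right.1 hlhs
    have hbuf : bufFact j F m z ∈ Q := by
      cases he with
      | output G hG z hz => exact hz
      | input G hG z => exact absurd hF (not_mem_outS_of_mem_inS hG.1)
    refine ⟨S, .inl rfl, ?_⟩
    have hns : nextState Q (.inr ⟨.buf j F, m, z⟩) = ProtoImpl.update {bufFact j F m z} 0 Q := by
      simp [nextState, hF]
    rw [hr, hl, hns, update_zero_left]
    have hQ := Matches.singleton hbuf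
    rw [add_left_comm] at h
    -- The reverse move: the role gives up the buffered fact and the environment gains its plain
    -- form.
    have := h.move (hQ.mono (Multiset.le_add_right _ _)) (r := {extEnvFact F t}) (by
      rw [Multiset.map_singleton, Multiset.map_singleton,
        factClass_bufFact_eq fun j => (ht j).trans (hz j).symm])
    rw [update_add_right hQ.1, ← update_zero_add] at this
    convert this using 1
    abel
  | setup j r x hr =>
    rw [hact] at ha
    obtain ⟨f, hf, hfe⟩ := rel_singleton_right ha
    rw [subst_setupLabel] at hfe
    obtain ⟨m', z', rfl, hrid, hz⟩ := eqMod_syncFact hfe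
    cases syncFact_injective (Multiset.singleton_inj.1 hf)
    have hgr : g.rhs = 0 := Multiset.rel_zero_right.1 hrhs
    obtain ⟨f, hf, hsym, -⟩ := hr.2
    have hract : r.act = 0 := (hR.setup_rule j r hr.1 f hf hsym).2
    -- The label carries all variables of the setup rule, so synchronizing on it forces both halves
    -- to use the same instance modulo `E`.
    have hval : ∀ y ∈ r.vars, EqMod E (setupVal m z y) (θ y) := by
      intro y hy
      by_cases hyx : y = x
      · subst hyx
        rwa [show setupVal m z y = m by simp [setupVal]]
      · have := hz ⟨y, hy, hyx⟩
        rwa [show setupVal m z y = z ⟨y, hy, hyx⟩ from dif_pos ⟨hy, hyx⟩]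
    -- The rule fires under the environment's `θ`, which is known to respect sorts; the role's
    -- valuation need not.
    obtain ⟨S', hS', hsim⟩ := h.fire (hm.mono (Multiset.le_add_right _ _)) (rules := R.rules)
      (.inl hr.1) hθ (r := (r.rhs.map liftFact).map (Fact.subst (setupVal m z))) (a := 0)
      (by
        have := map_factClass_eq hlhs
        rw [Rule.subst, map_subst_map_liftFact, Multiset.map_map] at this
        exact this)
      (by
        rw [map_subst_map_liftFact, Multiset.map_map, Multiset.map_map, Multiset.map_map]
        refine Multiset.map_congr rfl fun f hf => factClass_liftFact_eq_iff.2 ?_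
        refine .mk f.sym _ _ fun a => EqMod.subst _ fun y hy => hval y ?_
        exact ⟨f, Multiset.mem_add.2 (.inr hf), Set.mem_iUnion.2 ⟨a, hy⟩⟩)
      (by rw [hract]; exact .zero)
    refine ⟨S', .inr hS', ?_⟩
    rw [hgr]
    rw [update_add_right hm.1, ← update_zero_add] at hsim
    convert hsim using 1
    rw [nextState]
    abel

end SyncLabels

/-! ## Runs of the composed system -/

section SystemRuns

theorem LTS.Run.snoc {L : Type u} {M : LTS.{u, w} L} {s s' s'' : M.State} {τ : List L} {a : L}
    (h : M.Run s τ s') (ha : M.step s' a s'') : M.Run s (τ ++ [a]) s'' := by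
  induction h with
  | nil s => exact .cons ha (.nil _)
  | cons h _ ih => exact .cons h (ih ha)

/-- Isolates the contribution of thread `k`. The set `s` may have to grow by `k`, as this can be the
first event of that thread. -/
theorem exists_sum_split {ι L M : Type*} [DecidableEq ι] [AddCommMonoid M] (F : List L → M)
    (hF : F [] = 0) (h : ι → List L) {s : Finset ι} (hs : ∀ k ∉ s, h k = []) (k : ι) :
    ∃ (rest : M) (s' : Finset ι), ∑ j ∈ s, F (h j) = F (h k) + rest ∧
      ∀ l, (∀ j ∉ s', Function.update h k l j = []) ∧
        ∑ j ∈ s', F (Function.update h k l j) = F l + rest := by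
  refine ⟨∑ j ∈ s.erase k, F (h j), insert k s, ?_, fun l => ⟨?_, ?_⟩⟩
  · by_cases hk : k ∈ s
    · exact (Finset.add_sum_erase s (fun j => F (h j)) hk).symm
    · rw [hs k hk, hF, zero_add, Finset.erase_eq_of_notMem hk]
  · intro j hj
    rw [Finset.mem_insert, not_or] at hj
    rw [Function.update_of_ne hj.1, hs j hj.2]
  · rw [← Finset.add_sum_erase _ _ (Finset.mem_insert_self k s), Function.update_self,
      Finset.erase_insert_eq_erase]
    congr 1
    refine Finset.sum_congr rfl fun j hj => ?_
    rw [Function.update_of_ne (Finset.ne_of_mem_erase hj)]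

variable {T : TermSig.{u}} {n : ℕ} {P : ProtoSig.{u} n} {E : EqTheory T} {B : Type u}

/-- The event of an I/O specification that a program's label stands for. -/
def eraseBytes : ProgLabel T P B → SpecLabel T P
  | .inl e => .inl e
  | .inr c => .inr ⟨c.op, c.rid, c.arg⟩

theorem eq_eraseBytes {A : ByteOps T B} {b : ProgLabel T P B} {e : SpecLabel T P}
    (h : piExtConc A b = some e) : e = eraseBytes b := by
  cases b with
  | inl x => exact (Option.some.inj h).symm
  | inr c =>
    unfold piExtConc at h
    dsimp only at h
    split_ifs at h
    exact (Option.some.inj h).symm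

theorem map_eraseBytes_of_forall₂ {A : ByteOps T B} {τ : List (ProgLabel T P B)}
    {τ' : List (SpecLabel T P)} (h : List.Forall₂ (fun c e => piExtConc A c = some e) τ τ') :
    τ' = τ.map eraseBytes := by
  induction h with
  | nil => rfl
  | cons h _ ih => rw [List.map_cons, ← eq_eraseBytes h, ih]

variable {R : Model T P} {res : EqRestriction P} {A : ByteOps T B}

/-- The run extended by `b` is still a trace of the program, hence of the specification after
erasing bytes; enabledness of its last event is the claim. -/
theorem enabled_of_abstractsTo {C : LTS.{u, w} (ProgLabel T P B)} {i : Fin n} {rid : T.Fresh}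
    (hC : AbstractsTo (piExtConc A) C (R.ioSpec E res i rid)) {τ : List (ProgLabel T P B)}
    {s s' : C.State} {b : ProgLabel T P B} (hτ : C.Run C.start τ s) (hb : C.step s b s') :
    piExtConc A b = some (eraseBytes b) ∧
      R.Enabled E res i rid (stateAt (τ.map eraseBytes)) (eraseBytes b) := by
  obtain ⟨τ', hτ', hf⟩ := hC _ ⟨_, hτ.snoc hb⟩
  have hmap := map_eraseBytes_of_forall₂ hf
  refine ⟨?_, Model.enabled_of_mem_ioSpec_Tr hτ' (b := []) (by simpa using hmap)⟩
  rw [hmap, List.map_append, List.map_singleton] at hf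
  have := (List.forall₂_iff_get.1 hf).2 τ.length (by simp) (by simp)
  simpa using this

/-- Prevents either side from performing an interface operation on its own. -/
theorem synced_of_isOp {q : SyncSym T P} (hq : R.IsOp q) {m : Msg T} {b : q.Param → B}
    {z : q.Param → Msg T} (hb : b = fun j => A.gamma (z j)) :
    ∃ c ∈ R.concSyncLabels A, SysLabel.EqMod E (.inr ⟨q, m, b, z⟩) c :=
  ⟨.inr ⟨q, m, b, z⟩, ⟨.inr ⟨q, m, z⟩, by simp [piExtConc, hb], hq.mem_syncLabels m z⟩,
    .inr (.mk q m m b z z (.refl _) fun _ => .refl _)⟩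

theorem exists_syncFact_of_synced {a : Multiset (GFact T (extSig T P))}
    (h : ∃ c ∈ R.concSyncLabels A, SysLabel.EqMod E (.inl a) c) :
    ∃ q m z, a = {syncFact q m z} := by
  obtain ⟨c, ⟨e, he, hmem⟩, hc⟩ := h
  cases hc with
  | inl hc =>
    cases Option.some.inj he
    obtain ⟨q, m, z, hq⟩ := exists_eq_singleton_of_mem_syncLabels hmem
    simp only [piExt] at hq
    rw [hq] at hc
    obtain ⟨f, rfl, hf⟩ := rel_singleton_right hc
    obtain ⟨m', z', rfl, -⟩ := eqMod_syncFact hf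
    exact ⟨q, m', z', rfl⟩

open Classical in
/-- The nonempty labels of a trace. -/
def nonemptyLabels {L : Type u} (ε : L) (τ : List L) : List L :=
  τ.filter (fun a => a ≠ ε)

theorem nonemptyLabels_append {L : Type u} (ε : L) (τ τ' : List L) :
    nonemptyLabels ε (τ ++ τ') = nonemptyLabels ε τ ++ nonemptyLabels ε τ' :=
  List.filter_append _ _

theorem nonemptyLabels_self {L : Type u} (ε : L) : nonemptyLabels ε [ε] = [] := by
  simp [nonemptyLabels]

theorem nonemptyLabels_of_ne {L : Type u} {ε a : L} (h : a ≠ ε) : nonemptyLabels ε [a] = [a] := by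
  simp [nonemptyLabels, h]

/-- The state of the composed system after the trace `σ` is represented by a state that the model
reaches by a trace with the same nonempty labels. -/
def SystemInv (R : Model T P) (E : EqTheory T) (res : EqRestriction P)
    (C : Fin n → T.Fresh → LTS.{u, w} (ProgLabel T P B)) (σ : List (SysLabel T P B))
    (f : ∀ k : Fin n × T.Fresh, (C k.1 k.2).State) (env : Multiset (GFact T (extSig T P))) :
    Prop :=
  ∃ (h : Fin n × T.Fresh → List (ProgLabel T P B)) (K : Finset (Fin n × T.Fresh))
    (S : Multiset (GFact T P.base)) (τ : List (Multiset (GFact T P.base))),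
    (∀ k, (C k.1 k.2).Run (C k.1 k.2).start (h k) (f k)) ∧ (∀ k ∉ K, h k = []) ∧
    Simulates E S (env + ∑ k ∈ K, stateAt ((h k).map eraseBytes)) ∧
    (msrLTS E (fun _ => True) R.rules).Run (msrLTS E (fun _ => True) R.rules).start τ S ∧
    nonemptyLabels (.inl 0) σ = asSystemTrace B (nonemptyLabels 0 τ) ∧
    ∀ a ∈ τ, EqChecks E res (a.map liftFact)

theorem nonemptyLabels_snoc {σ : List (SysLabel T P B)} {τ : List (Multiset (GFact T P.base))}
    (h : nonemptyLabels (.inl 0) σ = asSystemTrace B (nonemptyLabels 0 τ))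
    (a : Multiset (GFact T P.base)) :
    nonemptyLabels (.inl 0) (σ ++ [.inl (a.map liftFact)]) =
      asSystemTrace B (nonemptyLabels 0 (τ ++ [a])) := by
  rw [nonemptyLabels_append, nonemptyLabels_append, h, asSystemTrace, asSystemTrace,
    List.map_append]
  congr 1
  by_cases ha : a = 0
  · rw [ha, Multiset.map_zero, nonemptyLabels_self, nonemptyLabels_self, List.map_nil]
  · rw [nonemptyLabels_of_ne ha, nonemptyLabels_of_ne (by simpa using ha), List.map_singleton]

theorem SystemInv.step (hR : R.Format) {C : Fin n → T.Fresh → LTS.{u, w} (ProgLabel T P B)}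
    (hC : ∀ i rid, AbstractsTo (piExtConc A) (C i rid) (R.ioSpec E res i rid))
    {σ : List (SysLabel T P B)} {f f' : ∀ k : Fin n × T.Fresh, (C k.1 k.2).State}
    {env env' : Multiset (GFact T (extSig T P))} {a : SysLabel T P B}
    (hs : SystemInv R E res C σ f env)
    (ha : (R.system E res A C).step (f, env) a (f', env')) :
    SystemInv R E res C (σ ++ [a]) f' env' := by
  let : DecidableEq (Fin n × T.Fresh) := fun a b => Classical.propDecidable (a = b)
  obtain ⟨h, K, S, τ, hrun, hK, hsim, hτ, hσ, hchk⟩ := hs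
  have hupd : ∀ (k : Fin n × T.Fresh) (b : ProgLabel T P B) (t : (C k.1 k.2).State),
      (C k.1 k.2).step (f k) b t → ∀ j, (C j.1 j.2).Run (C j.1 j.2).start
        (Function.update h k (h k ++ [b]) j) (Function.update f k t j) := by
    intro k b t hb j
    by_cases hj : j = k
    · subst hj
      rw [Function.update_self, Function.update_self]
      exact (hrun j).snoc hb
    · rw [Function.update_of_ne hj, Function.update_of_ne hj]
      exact hrun j
  rcases ha with ⟨rfl, b, hsync, hprog, henv⟩ | ⟨hns, hprog, henv⟩ | ⟨hns, henv, hprog⟩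
  -- Synchronized transition.
  · obtain ⟨k, t, ⟨b, rfl, hb⟩, hf'⟩ := hprog
    obtain rfl : f' = Function.update f k t := hf'
    obtain ⟨-, hen⟩ := enabled_of_abstractsTo (hC k.1 k.2) (hrun k) hb
    obtain ⟨a₀, hren, r', hr', θ, hθ, g, hg, hm, -, rfl, rfl⟩ := henv
    cases b with
    | inl e =>
      obtain ⟨q, m, z, hq⟩ := exists_syncFact_of_synced hsync
      generalize hga : g.act = ga at hren
      generalize hcc : piInt (Sum.inl e) = cc at hren
      cases hren with
      | sync _ _ _ => cases hcc
      -- An internal label in $\Lambda'$ would be a synchronization fact, but the environment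
      -- renames such labels to interface labels.
      | keep _ hne => exact absurd ((Sum.inl.inj hcc).symm.trans hq) (hne q m z)
    | inr c =>
      obtain ⟨q, m, z, hact, rfl⟩ : ∃ q m z, g.act = {syncFact q m z} ∧
          c = ⟨q, m, fun j => A.gamma (z j), z⟩ := by
        generalize hga : g.act = ga at hren
        generalize hcc : piInt (Sum.inr c) = cc at hren
        cases hren with
        | sync q m z => exact ⟨q, m, z, rfl, Sum.inr.inj hcc⟩
        | keep _ _ => cases hcc
      rcases hr' with ⟨r, -, -, rfl⟩ | hr'
      · have hga : Multiset.Rel (Fact.EqMod E) g.act ((r.act.map (Fact.subst θ)).map liftFact) := by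
          rw [← map_subst_map_liftFact]
          exact hg.2.1
        obtain ⟨a₁, ha₁, -⟩ := exists_eq_map_liftFact hga
        exact absurd (ha₁.symm.trans hact) (map_liftFact_ne_syncFact _ _ _ _)
      · obtain ⟨rest, K', hsum, hK'⟩ := exists_sum_split
          (fun l : List (ProgLabel T P B) => stateAt (l.map eraseBytes)) rfl h hK k
        rw [hsum] at hsim
        obtain ⟨S', hS', hsim'⟩ := Simulates.sync hR hsim hen hr' hθ hg hm hact
        have hsim'' : Simulates E S' (update g.lhs g.rhs env + ∑ j ∈ K', stateAt
            ((Function.update h k (h k ++ [.inr ⟨q, m, fun j => A.gamma (z j), z⟩]) j).map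
              eraseBytes)) := by
          rw [(hK' _).2, List.map_append, List.map_singleton, stateAt_append]
          exact hsim'
        rcases hS' with rfl | hS'
        · exact ⟨_, K', S', τ, hupd k _ t hb, (hK' _).1, hsim'', hτ,
            by rw [nonemptyLabels_append, nonemptyLabels_self, List.append_nil, hσ], hchk⟩
        · refine ⟨_, K', S', τ ++ [0], hupd k _ t hb, (hK' _).1, hsim'', hτ.snoc hS',
            nonemptyLabels_snoc hσ 0, ?_⟩
          intro a ha
          rcases List.mem_append.1 ha with ha | ha
          · exact hchk a ha
          · rw [List.mem_singleton.1 ha]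
            intro f φ _ t ht
            simp at ht
  -- A program moves alone, so its event must be internal.
  · obtain ⟨k, t, ⟨b, rfl, hb⟩, hf'⟩ := hprog
    obtain rfl : f' = Function.update f k t := hf'
    obtain rfl : env' = env := henv
    obtain ⟨hext, hen⟩ := enabled_of_abstractsTo (hC k.1 k.2) (hrun k) hb
    cases b with
    | inr c =>
      obtain ⟨q, m, bs, z⟩ := c
      -- Definedness of $\pi'_{ext}$ makes the bytestrings the images of the ghost terms, which puts
      -- the label into $\Lambda'$.
      refine absurd (synced_of_isOp hen.isOp ?_) hns
      by_contra hne
      simp [piExtConc, hne] at hext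
    | inl e =>
      obtain ⟨rest, K', hsum, hK'⟩ := exists_sum_split
        (fun l : List (ProgLabel T P B) => stateAt (l.map eraseBytes)) rfl h hK k
      rw [hsum, add_left_comm] at hsim
      cases hen with
      | proto r x hr hx θ g hθ hm hg hc =>
        have hga : Multiset.Rel (Fact.EqMod E) g.act ((r.act.map (Fact.subst θ)).map liftFact) := by
          rw [← map_subst_map_liftFact]
          exact hg.2.1
        obtain ⟨a₁, ha₁, hrel⟩ := exists_eq_map_liftFact hga
        obtain ⟨S', hS', hsim'⟩ := hsim.fire (hm.mono (Multiset.le_add_right _ _))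
          (rules := R.rules) (.inr (Set.mem_iUnion.2 ⟨k.1, hr⟩)) hθ (r := g.rhs)
          ((map_factClass_eq hg.1).trans (map_factClass_bufferFact _ _ _ _))
          ((map_factClass_eq hg.2.2).trans (map_factClass_bufferFact _ _ _ _)) hrel
        refine ⟨_, K', S', τ ++ [a₁], hupd k _ t hb, (hK' _).1, ?_, hτ.snoc hS', ?_, ?_⟩
        · rw [(hK' _).2, List.map_append, List.map_singleton, stateAt_append]
          rw [update_add_right hm.1, add_left_comm] at hsim'
          exact hsim'
        · have := nonemptyLabels_snoc (B := B) hσ a₁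
          rw [← ha₁] at this
          exact this
        · intro a ha
          rcases List.mem_append.1 ha with ha | ha
          · exact hchk a ha
          · rw [List.mem_singleton.1 ha, ← ha₁]
            exact hc
  -- The environment moves alone, so its rule is not an interface half.
  · obtain rfl : f' = f := hprog
    obtain ⟨a₀, hren, r', hr', θ, hθ, g, hg, hm, hc, rfl, rfl⟩ := henv
    rcases hr' with ⟨r, hr, -, rfl⟩ | hr'
    · have hga : Multiset.Rel (Fact.EqMod E) g.act ((r.act.map (Fact.subst θ)).map liftFact) := by
        rw [← map_subst_map_liftFact]
        exact hg.2.1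
      obtain ⟨a₁, ha₁, hrel⟩ := exists_eq_map_liftFact hga
      have hlift : ∀ s : Multiset (Fact T P.base Var),
          ((s.map liftFact).map (Fact.subst θ)).map (factClass E) =
            (s.map (Fact.subst θ)).map fun f => factClass E (liftFact f) := by
        intro s
        rw [map_subst_map_liftFact, Multiset.map_map]
        rfl
      obtain ⟨S', hS', hsim'⟩ := hsim.fire (hm.mono (Multiset.le_add_right _ _))
        (rules := R.rules) (.inl hr) hθ (r := g.rhs) ((map_factClass_eq hg.1).trans (hlift _))
        ((map_factClass_eq hg.2.2).trans (hlift _)) hrel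
      rw [update_add_right hm.1] at hsim'
      obtain rfl : a = .inl (a₁.map liftFact) := by
        rw [ha₁] at hren
        generalize hga : a₁.map liftFact = ga at hren
        cases hren with
        | sync q m z => exact absurd hga (map_liftFact_ne_syncFact _ _ _ _)
        | keep _ _ => rfl
      refine ⟨h, K, S', τ ++ [a₁], hrun, hK, hsim', hτ.snoc hS', nonemptyLabels_snoc hσ a₁, ?_⟩
      intro a ha
      rcases List.mem_append.1 ha with ha | ha
      · exact hchk a ha
      · rw [List.mem_singleton.1 ha, ← ha₁]
        exact hc
    · obtain ⟨q, m, z, hact, hq⟩ := hr'.exists_act hg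
      rw [hact] at hren
      generalize hga : ({syncFact q m z} : Multiset (GFact T (extSig T P))) = ga at hren
      cases hren with
      | sync q' m' z' =>
        cases syncFact_injective (Multiset.singleton_inj.1 hga)
        exact absurd (synced_of_isOp hq rfl) hns
      | keep _ hne => exact absurd hga.symm (hne q m z)

theorem SystemInv.run (hR : R.Format) {C : Fin n → T.Fresh → LTS.{u, w} (ProgLabel T P B)}
    (hC : ∀ i rid, AbstractsTo (piExtConc A) (C i rid) (R.ioSpec E res i rid))
    {s s' : (R.system E res A C).State} {ρ : List (SysLabel T P B)}
    (hρ : (R.system E res A C).Run s ρ s') :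
    ∀ σ, SystemInv R E res C σ s.1 s.2 → SystemInv R E res C (σ ++ ρ) s'.1 s'.2 := by
  induction hρ with
  | nil s => intro σ hσ; simpa using hσ
  | cons hstep _ ih =>
    intro σ hσ
    simpa using ih _ (hσ.step hR hC hstep)

theorem SystemInv.start (C : Fin n → T.Fresh → LTS.{u, w} (ProgLabel T P B)) :
    SystemInv R E res C [] (fun k => (C k.1 k.2).start) 0 := by
  refine ⟨fun _ => [], ∅, 0, [], fun k => .nil _, fun _ _ => rfl, ?_, .nil _, rfl, by simp⟩
  rw [Finset.sum_empty]
  exact ⟨rfl, fun f hf => absurd hf (Multiset.notMem_zero f)⟩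

/-- Programs that satisfy their I/O specifications, composed with the concrete environment, have
only traces of the model. -/
theorem Model.systemTrT_subset (hR : R.Format)
    {C : Fin n → T.Fresh → LTS.{u, w} (ProgLabel T P B)}
    (hC : ∀ i rid, AbstractsTo (piExtConc A) (C i rid) (R.ioSpec E res i rid)) :
    systemTrT (R.system E res A C) ⊆ asSystemTrace B '' R.TrT E res := by
  rintro _ ⟨⟨ρ, ⟨s, hρ⟩, rfl⟩, hgen⟩
  obtain ⟨h, K, S, τ, -, -, -, hτ, hfilter, hchk⟩ :=
    SystemInv.run hR hC hρ [] (SystemInv.start C)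
  rw [List.nil_append] at hfilter
  change ∀ (m : Msg T) (i j : Fin (nonemptyLabels (.inl 0) ρ).length),
    (∃ a, (nonemptyLabels (.inl 0) ρ).get i = .inl a ∧ _) →
    (∃ a, (nonemptyLabels (.inl 0) ρ).get j = .inl a ∧ _) → i = j at hgen
  refine ⟨nonemptyLabels 0 τ, ⟨⟨⟨τ, ⟨S, hτ⟩, rfl⟩, ?_⟩, ?_⟩, hfilter.symm⟩
  -- Both traces agree position by position, so two records of one fresh value in the model trace
  -- would give two in the system trace.
  · rw [hfilter] at hgen
    have hlen : (nonemptyLabels 0 τ).length = (asSystemTrace B (nonemptyLabels 0 τ)).length := by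
      rw [asSystemTrace, List.length_map]
    intro m i j hi hj
    have hij := hgen m (i.cast hlen) (j.cast hlen)
      ⟨_, by simp [asSystemTrace]; rfl, Multiset.mem_map_of_mem _ hi⟩
      ⟨_, by simp [asSystemTrace]; rfl, Multiset.mem_map_of_mem _ hj⟩
    have hval := congrArg Fin.val hij
    exact Fin.ext hval
  · intro a ha
    exact hchk a (List.mem_filter.1 ha).1

end SystemRuns

end

end ProtoImpl

/-- Soundness of the verifier turns each triple into the trace inclusion that the simulation needs.
-/
theorem corollary1 {n : ℕ} (T : ProtoImpl.TermSig.{u}) (E : ProtoImpl.EqTheory T)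
    (P : ProtoImpl.ProtoSig.{u} n) (R : ProtoImpl.Model T P) (hR : R.Format)
    (res : ProtoImpl.EqRestriction P)
    {B : Type u} (A : ProtoImpl.ByteAlgebra E B)
    {Prog : Type v} (sem : Prog → ProtoImpl.LTS.{u, w} (ProtoImpl.ProgLabel T P B))
    (Triple : (ProtoImpl.ProgLabel T P B → Option (ProtoImpl.SpecLabel T P)) →
      ProtoImpl.Assertion T P → Prog → Prop)
    (hsound : ProtoImpl.VerifierAssumption sem Triple)
    (prog : Fin n → T.Fresh → Prog)
    (hverified : ∀ (i : Fin n) (rid : T.Fresh),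
      Triple (ProtoImpl.piExtConc A.toByteOps) (R.ioSpec E res i rid) (prog i rid))
    (Φ : Set (List (Multiset (ProtoImpl.GFact T P.base))))
    (hΦ : R.TrT E res ⊆ Φ) :
    ProtoImpl.systemTrT (R.system E res A.toByteOps (fun i rid => sem (prog i rid))) ⊆
      ProtoImpl.asSystemTrace B '' Φ := by
  exact (ProtoImpl.Model.systemTrT_subset hR fun i rid => hsound _ _ _ (hverified i rid)).trans
    (Set.image_mono hΦ)
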